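/- Let $\mathbb{T}$ be an infinite random recursive tree on the vertices $1,2,3,\dots$: vertex $1$ is the root, and the parents $u_i$ of the vertices $i\ge 2$ are independent, with $u_i$ uniformly distributed on $\{1,\dots,i-1\}$. For $i\ge 2$ let $e_i$ be the edge between $i$ and $u_i$, and let $(\epsilon_i)_{i\ge 2}$ be i.i.d. standard exponential random variables, independent of $\mathbb{T}$. For $t\ge 0$ remove all edges $e_i$ with $\epsilon_i\le t$, and let $\Pi_1(t),\Pi_2(t),\dots$ be the vertex sets of the connected components of the resulting forest, listed in increasing order of their smallest elements. Fix $t>0$. Then for every $n\ge 1$ the limit $$X_n(t)=\lim_{N\to\infty}N^{-e^{-t}}\,\#\{j\le N: j\in\Pi_n(t)\}$$ (the weight of the $n$-th block) exists in $(0,\infty)$ almost surely, and, as $n\to\infty$, $$n^{e^{-t}}X_n(t)\Longrightarrow V^{e^{-t}}X_1(t)\quad\text{in distribution},$$ where $V$ is an exponential random variable with parameter (rate) $(1-e^{-t})^{-1}$, i.e. with mean $1-e^{-t}$, which is independent of $X_1(t)$. -/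

import Mathlib

open MeasureTheory ProbabilityTheory Filter Topology

namespace RecursiveTreeDestruction

/-! Vertices are the positive natural numbers `1, 2, 3, …` (the natural number `0` is not a vertex).
For `2 ≤ i`, the edge `e_i` joins the vertex `i` to its parent `u i`. -/

/-- An infinite random recursive tree on the vertices `1, 2, …`, given by the parents `u i` of the
vertices `i ≥ 2`, together with the independent standard exponential times `ε i` at which the
edges `e_i` are removed: the `u i` are independent, `u i` is uniform on `{1, …, i - 1}`, and the
`ε i` are i.i.d. standard exponential and independent of the tree. -/
structure IsModel {Ω : Type*} [MeasurableSpace Ω] (μ : Measure Ω)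
    (u : ℕ → Ω → ℕ) (ε : ℕ → Ω → ℝ) : Prop where
  measurable_parent : ∀ i, 2 ≤ i → Measurable (u i)
  measurable_time : ∀ i, 2 ≤ i → Measurable (ε i)
  law_parent : ∀ i, 2 ≤ i → μ.map (u i) = uniformOn (Set.Icc 1 (i - 1))
  law_time : ∀ i, 2 ≤ i → μ.map (ε i) = expMeasure 1
  indep_parent : iIndepFun (fun i : {i : ℕ // 2 ≤ i} => u i) μ
  indep_time : iIndepFun (fun i : {i : ℕ // 2 ≤ i} => ε i) μ
  indep_tree_time : IndepFun (fun (ω : Ω) (i : {i : ℕ // 2 ≤ i}) => u i ω)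
    (fun (ω : Ω) (i : {i : ℕ // 2 ≤ i}) => ε i ω) μ

/-- The forest left at time `t` of the tree with parent map `u`, when the edge `e_j` between
`j ≥ 2` and its parent is removed at time `e j`. -/
def forest (u : ℕ → ℕ) (e : ℕ → ℝ) (t : ℝ) : SimpleGraph ℕ :=
  SimpleGraph.fromRel fun i j => 1 ≤ i ∧ 2 ≤ j ∧ u j = i ∧ t < e j

/-- The set of vertices which are connected to `i` at time `t`. -/
def cluster (u : ℕ → ℕ) (e : ℕ → ℝ) (t : ℝ) (i : ℕ) : Set ℕ :=
  {j | 1 ≤ j ∧ (forest u e t).Reachable i j}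

/-- The vertex `i` is the smallest element of its cluster at time `t`. -/
def IsSmallest (u : ℕ → ℕ) (e : ℕ → ℝ) (t : ℝ) (i : ℕ) : Prop :=
  1 ≤ i ∧ ∀ j ∈ cluster u e t i, i ≤ j

/-- The `n`-th block (`n = 1, 2, …`) of the partition into clusters at time `t`, when the clusters
are listed in increasing order of their smallest elements. (`Nat.nth` counts from `0`; if there are
fewer than `n` clusters, it returns `0`, and the `n`-th block is empty.) -/
noncomputable def block (u : ℕ → ℕ) (e : ℕ → ℝ) (t : ℝ) (n : ℕ) : Set ℕ :=
  cluster u e t (Nat.nth (IsSmallest u e t) (n - 1))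

/-- The rescaled number `N ^ (-exp (-t)) * #{j ≤ N : j ∈ B}` of the first `N` vertices that
belong to `B`. -/
noncomputable def partialWeight (t : ℝ) (B : Set ℕ) (N : ℕ) : ℝ :=
  (N : ℝ) ^ (-Real.exp (-t)) * ((B ∩ Set.Icc 1 N).ncard : ℝ)

/-- The weight at time `t` of a block `B`: the limit of `partialWeight t B N` as `N → ∞`
(meaningful when this limit exists). -/
noncomputable def weight (t : ℝ) (B : Set ℕ) : ℝ :=
  limUnder atTop (partialWeight t B)

/-- `X_n(t)`, the weight of the `n`-th block at time `t`, as a random variable. -/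
noncomputable def blockWeight {Ω : Type*} (u : ℕ → Ω → ℕ) (ε : ℕ → Ω → ℝ) (t : ℝ) (n : ℕ)
    (ω : Ω) : ℝ :=
  weight t (block (fun i => u i ω) (fun i => ε i ω) t n)

end RecursiveTreeDestruction

/-! Put a = e^(-t). At time t each vertex j ≥ 2 is, independently of the others, attached to each
earlier vertex with probability a / (j - 1) and is a root with probability 1 - a
(`IsModel.isRandomForest`). The blocks are the subtrees of the roots, so the n-th block is the
subtree of the n-th root R_n.

The subtree of a fixed vertex i has size T = 1 at time i and grows by one at step N + 1 with
conditional probability a T / N. Hence the mean of T (T + 1) ⋯ (T + p - 1) is multiplied by 1 + a p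
/ N at each step. The case p = 1 gives a martingale and the almost sure limit W_i of N^(-a) T; all p
together give the moments p! Γ(i) / Γ(i + a p) of W_i
(`IsRandomForest.lintegral_subtreeWeight_pow`).

The key observation is that a gamma variable G of shape i has E G^(a p) = Γ(i + a p) / Γ(i). If G is
independent of W_i, then G^a W_i has moments p!, so it is standard exponential
(`map_gamma_rpow_mul`). This is used three times. It forces W_i > 0. For large i, G is within order
√i of i, so i^a W_i is nearly exponential, with an explicit error (`abs_integral_rpow_mul_sub_le`).
For i = 1 it says that (V / (1 - a))^a X_1 is standard exponential.

The event R_n = i depends only on parents of vertices up to i, and W_i only on later ones. Since R_n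
≥ n, the error bound gives R_n^a X_n ⇒ E, a standard exponential. The law of large numbers gives n /
R_n → 1 - a, so by Slutsky n^a X_n ⇒ (1 - a)^a E, which is the law of V^a X_1. -/

namespace RecursiveTreeDestruction

/-! ### Components of the forest as subtrees of its roots. -/

/-- The parent of the vertex `j` in the forest at time `t`, or `0` if `j` has no parent there. -/
noncomputable def keptParent (u : ℕ → ℕ) (e : ℕ → ℝ) (t : ℝ) (j : ℕ) : ℕ :=
  -- The bounds on `u j` hold only almost surely; testing them makes the kept parent of every `j ≥
  -- 1` smaller than `j` at every outcome.
  if t < e j ∧ 1 ≤ u j ∧ u j < j then u j else 0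

/-- The vertex `j` descends from `i` along the parent map `w`. -/
inductive Desc (w : ℕ → ℕ) (i : ℕ) : ℕ → Prop
  | self : Desc w i i
  -- The condition `i < j` gives `Desc.le` for an arbitrary map `w`.
  | child {j : ℕ} : i < j → Desc w i (w j) → Desc w i j

/-- The vertex `j` is the root of a component of the forest with parent map `w`. -/
def IsRoot (w : ℕ → ℕ) (j : ℕ) : Prop := j = 1 ∨ (2 ≤ j ∧ w j = 0)

section Deterministic

variable {w : ℕ → ℕ} {i j N : ℕ}

theorem Desc.le (h : Desc w i j) : i ≤ j := by
  induction h with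
  | self => exact le_rfl
  | child h _ _ => exact h.le

theorem desc_iff_of_lt (h : i < j) : Desc w i j ↔ Desc w i (w j) := by
  refine ⟨fun hd => ?_, Desc.child h⟩
  cases hd with
  | self => exact absurd h (lt_irrefl _)
  | child _ hd => exact hd

open Classical in
/-- The number of descendants of `i` among the first `N` vertices. -/
noncomputable def subtreeSize (w : ℕ → ℕ) (i N : ℕ) : ℕ :=
  ((Finset.Icc 1 N).filter (Desc w i)).card

open Classical in
theorem subtreeSize_succ :
    subtreeSize w i (N + 1) = subtreeSize w i N + if Desc w i (N + 1) then 1 else 0 := by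
  unfold subtreeSize
  rw [← Finset.insert_Icc_right_eq_Icc_add_one (by omega), Finset.filter_insert]
  split_ifs with h
  · rw [Finset.card_insert_of_notMem (by simp)]
  · simp

theorem subtreeSize_le : subtreeSize w i N ≤ N := by
  classical
  exact (Finset.card_filter_le _ _).trans (by simp)

theorem subtreeSize_of_lt (h : N < i) : subtreeSize w i N = 0 := by
  classical
  rw [subtreeSize, Finset.card_eq_zero, Finset.filter_eq_empty_iff]
  intro j hj hd
  have := hd.le
  rw [Finset.mem_Icc] at hj
  omega

theorem subtreeSize_self (hi : 1 ≤ i) : subtreeSize w i i = 1 := by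
  obtain ⟨k, rfl⟩ := Nat.exists_eq_add_of_le' hi
  rw [subtreeSize_succ, subtreeSize_of_lt (by omega), if_pos Desc.self]

variable {u : ℕ → ℕ} {e : ℕ → ℝ} {t : ℝ}

theorem keptParent_eq_iff {v : ℕ} (hv : 1 ≤ v) :
    keptParent u e t j = v ↔ t < e j ∧ u j = v ∧ v < j := by
  unfold keptParent
  split_ifs with h
  · constructor
    · rintro rfl; exact ⟨h.1, rfl, h.2.2⟩
    · rintro ⟨_, h, _⟩; exact h
  · constructor
    · intro h'; omega
    · rintro ⟨h1, rfl, h3⟩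
      exact absurd ⟨h1, hv, h3⟩ h

theorem keptParent_lt (hj : 1 ≤ j) : keptParent u e t j < j := by
  unfold keptParent
  split_ifs with h <;> omega

theorem forest_adj_keptParent (h : 1 ≤ keptParent u e t j) :
    (forest u e t).Adj (keptParent u e t j) j := by
  obtain ⟨h1, h2, h3⟩ := (keptParent_eq_iff h).1 rfl
  rw [forest, SimpleGraph.fromRel_adj]
  exact ⟨by omega, Or.inl ⟨h, by omega, h2, h1⟩⟩

theorem Desc.reachable (hi : 1 ≤ i) (h : Desc (keptParent u e t) i j) :
    (forest u e t).Reachable i j := by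
  induction h with
  | self => exact SimpleGraph.Reachable.refl _
  | child _ hd ih => exact ih.trans (forest_adj_keptParent (hi.trans hd.le)).reachable

/-- A subtree can only be left along the edge from its top vertex to that vertex's parent, and a
root has no such edge. -/
theorem Desc.of_adj (hu : ∀ j, 2 ≤ j → 1 ≤ u j ∧ u j < j) (hi : IsRoot (keptParent u e t) i)
    {x y : ℕ} (hx : Desc (keptParent u e t) i x) (h : (forest u e t).Adj x y) :
    Desc (keptParent u e t) i y := by
  rw [forest, SimpleGraph.fromRel_adj] at h
  rcases h with ⟨_, ⟨h1, h2, h3, h4⟩ | ⟨h1, h2, h3, h4⟩⟩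
  · have hw : keptParent u e t y = x := (keptParent_eq_iff h1).2 ⟨h4, h3, h3 ▸ (hu y h2).2⟩
    refine Desc.child (lt_of_le_of_lt hx.le (h3 ▸ (hu y h2).2)) (hw ▸ hx)
  · have hw : keptParent u e t x = y := (keptParent_eq_iff h1).2 ⟨h4, h3, h3 ▸ (hu x h2).2⟩
    cases hx with
    | self =>
      rcases hi with hi | hi <;> omega
    | child _ hd => exact hw ▸ hd

theorem cluster_eq_of_isRoot (hu : ∀ j, 2 ≤ j → 1 ≤ u j ∧ u j < j)
    (hi : IsRoot (keptParent u e t) i) :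
    cluster u e t i = {j | Desc (keptParent u e t) i j} := by
  have hi1 : 1 ≤ i := by rcases hi with hi | hi <;> omega
  ext j
  refine ⟨fun ⟨_, hj⟩ => ?_, fun hj => ⟨hi1.trans hj.le, hj.reachable hi1⟩⟩
  obtain ⟨p⟩ := hj
  have key : ∀ {x y : ℕ} (_ : (forest u e t).Walk x y), Desc (keptParent u e t) i x →
      Desc (keptParent u e t) i y := by
    intro x y p
    induction p with
    | nil => exact id
    | cons h _ ih => exact fun hx => ih (hx.of_adj hu hi h)
  exact key p Desc.self

/-- A vertex that is not a root is joined to its smaller kept parent, while a root lies below all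
its descendants. So listing blocks by smallest element is listing roots in increasing order. -/
theorem isSmallest_iff_isRoot (hu : ∀ j, 2 ≤ j → 1 ≤ u j ∧ u j < j) :
    IsSmallest u e t i ↔ IsRoot (keptParent u e t) i := by
  constructor
  · rintro ⟨h1, h⟩
    rcases h1.eq_or_lt with h1 | h1
    · exact Or.inl h1.symm
    · refine Or.inr ⟨h1, ?_⟩
      by_contra h0
      have := h (keptParent u e t i) ⟨by omega,
        (forest_adj_keptParent (Nat.one_le_iff_ne_zero.2 h0)).reachable.symm⟩
      have := keptParent_lt (u := u) (e := e) (t := t) (j := i) (by omega)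
      omega
  · intro h
    refine ⟨by rcases h with h | h <;> omega, fun j hj => ?_⟩
    rw [cluster_eq_of_isRoot hu h] at hj
    exact hj.le

theorem partialWeight_cluster (hu : ∀ j, 2 ≤ j → 1 ≤ u j ∧ u j < j)
    (hi : IsRoot (keptParent u e t) i) :
    partialWeight t (cluster u e t i) N =
      (N : ℝ) ^ (-Real.exp (-t)) * (subtreeSize (keptParent u e t) i N : ℝ) := by
  classical
  rw [partialWeight, cluster_eq_of_isRoot hu hi, subtreeSize, ← Set.ncard_coe_finset]
  congr 3
  ext j
  simp [and_comm]

end Deterministic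

/-! ### Growth of a subtree: rising factorials and martingales. -/

/-- The random parent map of the random recursive forest in which the vertex `j ≥ 2` is attached
to each earlier vertex with probability `a / (j - 1)`, and becomes a root otherwise. -/
structure IsRandomForest {Ω : Type*} [MeasurableSpace Ω] (μ : Measure Ω) (w : ℕ → Ω → ℕ)
    (a : ℝ) : Prop where
  measurable : ∀ j, Measurable (w j)
  lt : ∀ j ω, 1 ≤ j → w j ω < j
  indep : iIndepFun (fun i : {i : ℕ // 2 ≤ i} => w i) μ
  prob_eq : ∀ j v, 1 ≤ v → v < j → μ.real {ω | w j ω = v} = a / (j - 1)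
  prob_root : ∀ j, 2 ≤ j → μ.real {ω | w j ω = 0} = 1 - a

section Sigma

variable {Ω : Type*} {w : ℕ → Ω → ℕ} {S T : Set ℕ} {i j N : ℕ}

/-- The σ-algebra generated by the parents of the vertices in `S`. -/
@[reducible] def parentSigma (w : ℕ → Ω → ℕ) (S : Set ℕ) : MeasurableSpace Ω :=
  ⨆ i ∈ {i : {i : ℕ // 2 ≤ i} | i.1 ∈ S}, MeasurableSpace.comap (w i.1) ⊤

theorem parentSigma_mono (h : S ⊆ T) : parentSigma w S ≤ parentSigma w T :=
  biSup_mono fun _ hi => h hi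

theorem parentSigma_le [mΩ : MeasurableSpace Ω] (hw : ∀ j, Measurable (w j)) :
    parentSigma w S ≤ mΩ :=
  iSup₂_le fun i _ => (hw i.1).comap_le

theorem measurable_parent_parentSigma (hj : 2 ≤ j) (h : j ∈ S) :
    Measurable[parentSigma w S] (w j) := by
  have : MeasurableSpace.comap (w j) ⊤ ≤ parentSigma w S :=
    le_biSup (fun i : {i : ℕ // 2 ≤ i} => MeasurableSpace.comap (w i.1) ⊤)
      (i := ⟨j, hj⟩) h
  exact Measurable.mono (comap_measurable (w j)) this le_rfl

/-- Whether `j` descends from `i` is decided by the parents of vertices in `(i, j]` alone. Excluding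
the parents up to `i` is what later makes the subtree of `i` independent of the past. -/
theorem measurableSet_desc (hlt : ∀ j ω, 1 ≤ j → w j ω < j) (hi : 1 ≤ i) (j : ℕ) :
    MeasurableSet[parentSigma w (Set.Ioc i j)] {ω | Desc (fun k => w k ω) i j} := by
  induction j using Nat.strong_induction_on with
  | _ j ih =>
    rcases lt_trichotomy j i with h | rfl | h
    · convert! @MeasurableSet.empty Ω (parentSigma w (Set.Ioc i j))
      ext ω
      simp only [Set.mem_ofPred_eq, Set.mem_empty_iff_false, iff_false]
      exact fun hd => absurd hd.le (by omega)
    · convert! @MeasurableSet.univ Ω (parentSigma w (Set.Ioc j j))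
      ext ω
      simp [Desc.self]
    · have : {ω | Desc (fun k => w k ω) i j} =
          ⋃ v ∈ Finset.range j, ({ω | Desc (fun k => w k ω) i v} ∩ w j ⁻¹' {v}) := by
        ext ω
        simp only [Set.mem_ofPred_eq, Set.mem_iUnion, Set.mem_inter_iff, Set.mem_preimage,
          Set.mem_singleton_iff, Finset.mem_range, exists_prop]
        rw [desc_iff_of_lt h]
        constructor
        · exact fun hd => ⟨w j ω, hlt j ω (by omega), hd, rfl⟩
        · rintro ⟨v, _, hd, rfl⟩
          exact hd
      rw [this]
      refine Finset.measurableSet_biUnion _ fun v hv => ?_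
      rw [Finset.mem_range] at hv
      refine MeasurableSet.inter
        (parentSigma_mono (Set.Ioc_subset_Ioc_right hv.le) _ (ih v hv)) ?_
      exact measurable_parent_parentSigma (S := Set.Ioc i j) (by omega) ⟨h, le_rfl⟩
        (MeasurableSet.singleton v)

theorem measurable_subtreeSize (hlt : ∀ j ω, 1 ≤ j → w j ω < j) (hi : 1 ≤ i) (N : ℕ) :
    Measurable[parentSigma w (Set.Ioc i N)] fun ω => subtreeSize (fun k => w k ω) i N := by
  classical
  induction N with
  | zero =>
    have : (fun ω => subtreeSize (fun k => w k ω) i 0) = fun _ => 0 :=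
      funext fun ω => subtreeSize_of_lt (by omega)
    rw [this]
    exact @measurable_const _ _ _ (parentSigma w _) _
  | succ N ih =>
    simp_rw [subtreeSize_succ]
    refine Measurable.add (Measurable.mono ih (parentSigma_mono
      (Set.Ioc_subset_Ioc_right N.le_succ)) le_rfl) ?_
    exact Measurable.ite (measurableSet_desc hlt hi _)
      (@measurable_const _ _ _ (parentSigma w _) _) (@measurable_const _ _ _ (parentSigma w _) _)

/-- The rising factorial `T (T + 1) ⋯ (T + p - 1)` of the size `T` of the subtree of `i`. -/
noncomputable def risingSize (w : ℕ → Ω → ℕ) (i p N : ℕ) (ω : Ω) : ℝ :=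
  ((subtreeSize (fun k => w k ω) i N).ascFactorial p : ℝ)

theorem measurable_risingSize (hlt : ∀ j ω, 1 ≤ j → w j ω < j) (hi : 1 ≤ i) (p N : ℕ) :
    Measurable[parentSigma w (Set.Ioc i N)] (risingSize w i p N) :=
  Measurable.comp (g := fun n : ℕ => (n.ascFactorial p : ℝ)) (measurable_of_countable _)
    (measurable_subtreeSize hlt hi N)

theorem risingSize_nonneg (p N : ℕ) (ω : Ω) : 0 ≤ risingSize w i p N ω := by
  unfold risingSize
  positivity

theorem risingSize_le (p N : ℕ) (ω : Ω) : risingSize w i p N ω ≤ (N.ascFactorial p : ℝ) := by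
  unfold risingSize
  exact_mod_cast Nat.ascFactorial_le p subtreeSize_le

/-- The information on the parents of the vertices up to `i + m`. -/
def forestFiltration [mΩ : MeasurableSpace Ω] (w : ℕ → Ω → ℕ) (hw : ∀ j, Measurable (w j)) (i : ℕ) :
    Filtration ℕ mΩ where
  seq m := parentSigma w (Set.Iic (i + m))
  mono' _ _ h := parentSigma_mono (Set.Iic_subset_Iic.2 (by omega))
  le' _ := parentSigma_le hw

variable [MeasurableSpace Ω] {μ : Measure Ω} {a : ℝ}

theorem IsRandomForest.indep_parentSigma (hw : IsRandomForest μ w a) (h : Disjoint S T) :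
    Indep (parentSigma w S) (parentSigma w T) μ := by
  have hind := (iIndepFun_iff_iIndep _ _ _).1 hw.indep
  refine indep_iSup_of_disjoint
    (m := fun i : {i : ℕ // 2 ≤ i} => MeasurableSpace.comap (w i.1) ⊤)
    (fun i => (hw.measurable i.1).comap_le) hind ?_
  exact Set.disjoint_left.2 fun i hi hi' => Set.disjoint_left.1 h hi hi'

theorem IsRandomForest.integral_mul_indicator (hw : IsRandomForest μ w a) {g : Ω → ℝ} {v : ℕ}
    (hg : Measurable[parentSigma w (Set.Iic N)] g) (hv : 1 ≤ v) (hvN : v ≤ N) :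
    ∫ ω, g ω * ({ω | w (N + 1) ω = v}.indicator (fun _ => (1 : ℝ)) ω) ∂μ
      = a / N * ∫ ω, g ω ∂μ := by
  have hN : MeasurableSet[parentSigma w {N + 1}] {ω | w (N + 1) ω = v} :=
    measurable_parent_parentSigma (S := {N + 1}) (by omega) rfl (MeasurableSet.singleton v)
  have hN' := parentSigma_le hw.measurable _ hN
  have hm : Measurable[parentSigma w {N + 1}]
      ({ω | w (N + 1) ω = v}.indicator (fun _ => (1 : ℝ))) :=
    Measurable.indicator (@measurable_const _ _ _ (parentSigma w _) _) hN
  have hind : IndepFun g ({ω | w (N + 1) ω = v}.indicator (fun _ => (1 : ℝ))) μ := by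
    rw [IndepFun_iff_Indep]
    refine indep_of_indep_of_le_left (indep_of_indep_of_le_right
      (hw.indep_parentSigma (S := Set.Iic N) (T := {N + 1}) ?_) hm.comap_le) hg.comap_le
    simp
  rw [hind.integral_fun_mul_eq_mul_integral
    (hg.mono (parentSigma_le hw.measurable) le_rfl).aestronglyMeasurable
    (hm.mono (parentSigma_le hw.measurable) le_rfl).aestronglyMeasurable,
    integral_indicator hN', setIntegral_const, hw.prob_eq _ _ hv (by omega), mul_comm]
  simp

/-- Integrated form of a conditional probability: `N + 1` joins the subtree exactly when its parent
is one of the members, each chosen with probability `a / N` independently of the past. -/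
theorem IsRandomForest.integral_mul_desc (hw : IsRandomForest μ w a) [IsFiniteMeasure μ]
    {g : Ω → ℝ} {C : ℝ} (hi : 1 ≤ i) (hiN : i ≤ N)
    (hg : Measurable[parentSigma w (Set.Iic N)] g) (hC : ∀ ω, |g ω| ≤ C) :
    ∫ ω, g ω * ({ω | Desc (fun k => w k ω) i (N + 1)}.indicator (fun _ => (1 : ℝ)) ω) ∂μ
      = a / N * ∫ ω, g ω * subtreeSize (fun k => w k ω) i N ∂μ := by
  classical
  have hd : ∀ v ∈ Finset.Icc 1 N, Measurable[parentSigma w (Set.Iic N)] fun ω =>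
      g ω * {ω | Desc (fun k => w k ω) i v}.indicator (fun _ => (1 : ℝ)) ω := by
    intro v hv
    rw [Finset.mem_Icc] at hv
    refine Measurable.mul hg (Measurable.indicator (@measurable_const _ _ _ (parentSigma w _) _) ?_)
    exact parentSigma_mono (fun k hk => hk.2.trans hv.2) _ (measurableSet_desc hw.lt hi v)
  have hbound : ∀ (A : Set Ω) (ω : Ω), |g ω * A.indicator (fun _ => (1 : ℝ)) ω| ≤ C := by
    intro A ω
    rw [abs_mul]
    by_cases h : ω ∈ A
    · simpa [h] using hC ω
    · simpa [h] using (abs_nonneg _).trans (hC ω)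
  have hint : ∀ v ∈ Finset.Icc 1 N, Integrable (fun ω =>
      g ω * {ω | Desc (fun k => w k ω) i v}.indicator (fun _ => (1 : ℝ)) ω) μ := by
    intro v hv
    exact Integrable.of_bound
      ((hd v hv).mono (parentSigma_le hw.measurable) le_rfl).aestronglyMeasurable C
      (.of_forall fun ω => hbound _ ω)
  have e1 : ∀ ω, g ω * {ω | Desc (fun k => w k ω) i (N + 1)}.indicator (fun _ => (1 : ℝ)) ω =
      ∑ v ∈ Finset.Icc 1 N, (g ω * {ω | Desc (fun k => w k ω) i v}.indicator (fun _ => 1) ω) *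
        {ω | w (N + 1) ω = v}.indicator (fun _ => (1 : ℝ)) ω := by
    intro ω
    simp_rw [mul_assoc, ← Finset.mul_sum]
    congr 1
    have hlt := hw.lt (N + 1) ω (by omega)
    simp only [Set.indicator_apply, Set.mem_ofPred_eq, mul_ite, mul_one, mul_zero]
    rw [Finset.sum_ite_eq]
    simp only [desc_iff_of_lt (show i < N + 1 by omega)]
    by_cases h : Desc (fun k => w k ω) i (w (N + 1) ω)
    · have := h.le
      rw [if_pos h, if_pos (Finset.mem_Icc.2 ⟨by omega, by omega⟩)]
    · simp [h]
  have e2 : ∀ ω, g ω * subtreeSize (fun k => w k ω) i N =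
      ∑ v ∈ Finset.Icc 1 N, g ω * {ω | Desc (fun k => w k ω) i v}.indicator (fun _ => 1) ω := by
    intro ω
    rw [← Finset.mul_sum, subtreeSize, Finset.card_filter]
    push_cast
    simp [Set.indicator_apply]
  simp_rw [e1, e2]
  rw [integral_finsetSum _ hint, integral_finsetSum, Finset.mul_sum]
  · refine Finset.sum_congr rfl fun v hv => ?_
    exact hw.integral_mul_indicator (hd v hv) (Finset.mem_Icc.1 hv).1 (Finset.mem_Icc.1 hv).2
  · intro v hv
    refine (hint v hv).mul_bdd (c := 1) ?_ (.of_forall fun ω => ?_)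
    · exact (measurable_const.indicator
        (hw.measurable (N + 1) (MeasurableSet.singleton v))).aestronglyMeasurable
    · by_cases h : ω ∈ {ω | w (N + 1) ω = v} <;> simp [h]

theorem IsRandomForest.integrable_risingSize [IsFiniteMeasure μ] (hw : IsRandomForest μ w a)
    (hi : 1 ≤ i) (p N : ℕ) : Integrable (risingSize w i p N) μ := by
  refine Integrable.of_bound ((measurable_risingSize hw.lt hi p N).mono
    (parentSigma_le hw.measurable) le_rfl).aestronglyMeasurable (N.ascFactorial p : ℝ)
    (.of_forall fun ω => ?_)
  rw [Real.norm_of_nonneg (risingSize_nonneg p N ω)]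
  exact risingSize_le p N ω

/-- When the size passes from `s` to `s + 1`, its rising factorial grows by `ψ s`, and `ψ s * s` is
`p` times the rising factorial of `s`. Multiplying by the conditional probability `a * s / N` closes
the recursion in the same `p`. -/
theorem IsRandomForest.setIntegral_risingSize_succ [IsFiniteMeasure μ]
    (hw : IsRandomForest μ w a) (hi : 1 ≤ i) (hiN : i ≤ N) (p : ℕ) {A : Set Ω}
    (hA : MeasurableSet[parentSigma w (Set.Iic N)] A) :
    ∫ ω in A, risingSize w i p (N + 1) ω ∂μ
      = (1 + a * p / N) * ∫ ω in A, risingSize w i p N ω ∂μ := by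
  classical
  have hA' := parentSigma_le hw.measurable _ hA
  set T : Ω → ℕ := fun ω => subtreeSize (fun k => w k ω) i N with hT
  have hTm : Measurable[parentSigma w (Set.Iic N)] T :=
    Measurable.mono (measurable_subtreeSize hw.lt hi N) (parentSigma_mono fun k hk => hk.2) le_rfl
  set ψ : ℕ → ℝ := fun s => ((s + 1).ascFactorial p : ℝ) - (s.ascFactorial p : ℝ) with hψ
  have hψT : ∀ s : ℕ, ψ s * s = p * (s.ascFactorial p : ℝ) := by
    intro s
    have := Nat.succ_ascFactorial s p
    have h2 : (s : ℝ) * ((s + 1).ascFactorial p : ℝ) = (s + p) * (s.ascFactorial p : ℝ) := by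
      exact_mod_cast this
    simp only [hψ]
    linarith
  set g : Ω → ℝ := A.indicator fun ω => ψ (T ω) with hg
  have hgm : Measurable[parentSigma w (Set.Iic N)] g :=
    Measurable.indicator (Measurable.comp (measurable_of_countable ψ) hTm) hA
  have hψ0 : ∀ s, 0 ≤ ψ s := fun s => sub_nonneg.2 (by
    exact_mod_cast Nat.ascFactorial_le p s.le_succ)
  have hgb : ∀ ω, |g ω| ≤ ((N + 1).ascFactorial p : ℝ) := by
    intro ω
    simp only [hg, Set.indicator_apply]
    split_ifs
    · rw [abs_of_nonneg (hψ0 _)]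
      have h1 : ((T ω + 1).ascFactorial p : ℝ) ≤ ((N + 1).ascFactorial p : ℝ) := by
        exact_mod_cast Nat.ascFactorial_le p (Nat.succ_le_succ subtreeSize_le)
      have h2 : (0 : ℝ) ≤ ((T ω).ascFactorial p : ℝ) := by positivity
      simp only [hψ]
      linarith
    · simp
  have e1 : ∀ ω, A.indicator (risingSize w i p (N + 1)) ω = A.indicator (risingSize w i p N) ω +
      g ω * {ω | Desc (fun k => w k ω) i (N + 1)}.indicator (fun _ => (1 : ℝ)) ω := by
    intro ω
    by_cases h : ω ∈ A
    · simp only [hg, h, Set.indicator_of_mem, risingSize, hψ, hT]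
      by_cases hd : Desc (fun k => w k ω) i (N + 1)
      · simp [hd, subtreeSize_succ]
      · simp [hd, subtreeSize_succ]
    · simp [hg, h]
  have e2 : ∀ ω, g ω * T ω = p * A.indicator (risingSize w i p N) ω := by
    intro ω
    by_cases h : ω ∈ A
    · simp only [hg, h, Set.indicator_of_mem, hψT]
      rfl
    · simp [hg, h]
  have hgd : Integrable (fun ω => g ω *
      {ω | Desc (fun k => w k ω) i (N + 1)}.indicator (fun _ => (1 : ℝ)) ω) μ := by
    refine (Integrable.of_bound (hgm.mono (parentSigma_le hw.measurable) le_rfl).aestronglyMeasurable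
      _ (.of_forall hgb)).mul_bdd (c := 1) ?_ (.of_forall fun ω => ?_)
    · exact (measurable_const.indicator (parentSigma_le hw.measurable _
        (measurableSet_desc hw.lt hi (N + 1)))).aestronglyMeasurable
    · by_cases h : ω ∈ {ω | Desc (fun k => w k ω) i (N + 1)} <;> simp [h]
  rw [← integral_indicator hA', ← integral_indicator hA', integral_congr_ae (.of_forall e1),
    integral_add ((hw.integrable_risingSize hi p N).indicator hA') hgd,
    hw.integral_mul_desc hi hiN hgm hgb, integral_congr_ae (.of_forall e2), integral_const_mul]
  ring

/-- The normalization `∏ (1 + x / k)`, over `i ≤ k < i + m`, of the growth of a subtree. -/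
noncomputable def growth (x : ℝ) (i m : ℕ) : ℝ := ∏ k ∈ Finset.range m, (1 + x / ((i + k : ℕ) : ℝ))

theorem growth_pos {x : ℝ} (hx : 0 ≤ x) (i m : ℕ) : 0 < growth x i m :=
  Finset.prod_pos fun _ _ => by positivity

theorem growth_succ (x : ℝ) (i m : ℕ) :
    growth x i (m + 1) = growth x i m * (1 + x / ((i + m : ℕ) : ℝ)) :=
  Finset.prod_range_succ _ _

theorem IsRandomForest.martingale_risingSize [IsFiniteMeasure μ] (hw : IsRandomForest μ w a)
    (ha : 0 ≤ a) (hi : 1 ≤ i) (p : ℕ) :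
    Martingale (fun m ω => risingSize w i p (i + m) ω / growth (a * p) i m)
      (forestFiltration w hw.measurable i) μ := by
  refine martingale_of_setIntegral_eq_succ (fun m => ?_) (fun m => ?_) fun m A hA => ?_
  · exact (Measurable.mono (Measurable.div_const (measurable_risingSize hw.lt hi p (i + m)) _)
      (parentSigma_mono fun k hk => hk.2) le_rfl).stronglyMeasurable
  · exact (hw.integrable_risingSize hi p _).div_const _
  · rw [integral_div, integral_div, ← add_assoc,
      hw.setIntegral_risingSize_succ hi (Nat.le_add_right i m) p hA, growth_succ]
    have h1 : 0 < growth (a * p) i m := growth_pos (by positivity) i m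
    have h2 : 0 < 1 + a * p / ((i + m : ℕ) : ℝ) := by positivity
    field_simp

theorem IsRandomForest.integral_risingSize [IsProbabilityMeasure μ] (hw : IsRandomForest μ w a)
    (hi : 1 ≤ i) (p m : ℕ) :
    ∫ ω, risingSize w i p (i + m) ω ∂μ = p.factorial * growth (a * p) i m := by
  induction m with
  | zero => simp [risingSize, subtreeSize_self hi, Nat.one_ascFactorial, growth]
  | succ m ih =>
    have := hw.setIntegral_risingSize_succ hi (Nat.le_add_right i m) p
      (A := Set.univ) (@MeasurableSet.univ _ (parentSigma w _))
    rw [setIntegral_univ, setIntegral_univ, ih] at this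
    rw [← add_assoc, this, growth_succ]
    ring

end Sigma

/-! ### Asymptotics of the normalization, and passage to the limit in moments. -/

theorem tendsto_growth {x : ℝ} (hx : 0 ≤ x) {i : ℕ} (hi : 1 ≤ i) :
    Tendsto (fun m : ℕ => ((i + m : ℕ) : ℝ) ^ (-x) * growth x i m) atTop
      (𝓝 (Real.Gamma i / Real.Gamma (i + x))) := by
  have hi0 : (0 : ℝ) < i := by exact_mod_cast hi
  have hG : Real.Gamma (i + x) ≠ 0 := (Real.Gamma_pos_of_pos (by positivity)).ne'
  -- The ratio of the two Euler sequences is `m ^ (-x) * growth x i (m + 1)`. The limit `h3`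
  -- replaces `m` by `i + m` in the power, and `h4` removes the last factor of the product.
  have h1 := (Real.GammaSeq_tendsto_Gamma i).div (Real.GammaSeq_tendsto_Gamma (i + x)) hG
  have h2 : Tendsto (fun m : ℕ => (m : ℝ) / ((i + m : ℕ) : ℝ)) atTop (𝓝 1) := by
    have := tendsto_natCast_div_add_atTop (i : ℝ)
    refine this.congr fun m => ?_
    push_cast
    rw [add_comm]
  have h3 : Tendsto (fun m : ℕ => ((m : ℝ) / ((i + m : ℕ) : ℝ)) ^ x) atTop (𝓝 1) := by
    simpa using h2.rpow_const (p := x) (Or.inl one_ne_zero)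
  have h4 : Tendsto (fun m : ℕ => 1 + x / ((i + m : ℕ) : ℝ)) atTop (𝓝 1) := by
    have : Tendsto (fun m : ℕ => ((i + m : ℕ) : ℝ)) atTop atTop :=
      tendsto_natCast_atTop_atTop.comp (tendsto_atTop_mono (fun m => Nat.le_add_left m i) tendsto_id)
    simpa using (this.const_div_atTop x).const_add 1
  have h5 := (h1.mul h3).div h4 one_ne_zero
  rw [mul_one, div_one] at h5
  refine h5.congr' ?_
  filter_upwards [eventually_gt_atTop 0] with m hm
  have hm0 : (0 : ℝ) < m := by exact_mod_cast hm
  have him : (0 : ℝ) < ((i + m : ℕ) : ℝ) := by positivity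
  have hgr : growth x i (m + 1) = (∏ j ∈ Finset.range (m + 1), ((i : ℝ) + x + j)) /
      ∏ j ∈ Finset.range (m + 1), ((i : ℝ) + j) := by
    rw [growth, ← Finset.prod_div_distrib]
    refine Finset.prod_congr rfl fun j _ => ?_
    have : (0 : ℝ) < i + j := by positivity
    push_cast
    field_simp
    ring
  rw [growth_succ] at hgr
  have hA : (0 : ℝ) < ∏ j ∈ Finset.range (m + 1), ((i : ℝ) + x + j) :=
    Finset.prod_pos fun j _ => by positivity
  have hB : (0 : ℝ) < ∏ j ∈ Finset.range (m + 1), ((i : ℝ) + j) :=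
    Finset.prod_pos fun j _ => by positivity
  have hC : 0 < 1 + x / ((i + m : ℕ) : ℝ) := by positivity
  have hf : (0 : ℝ) < (m.factorial : ℝ) := by positivity
  simp only [Pi.div_apply, Real.GammaSeq]
  rw [Real.div_rpow hm0.le him.le, Real.rpow_add hm0, Real.rpow_neg him.le,
    eq_div_of_mul_eq hC.ne' hgr]
  have := Real.rpow_pos_of_pos hm0 x
  have := Real.rpow_pos_of_pos hm0 i
  have := Real.rpow_pos_of_pos him x
  field_simp

/-- Convergence of expectations under a bound on the second moments. -/
theorem lintegral_eq_of_tendsto_integral {Ω : Type*} [MeasurableSpace Ω] {μ : Measure Ω}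
    [IsProbabilityMeasure μ] {X : ℕ → Ω → ℝ} {Y : Ω → ℝ} {L C : ℝ}
    (hX : ∀ n, Measurable (X n)) (hX0 : ∀ n ω, 0 ≤ X n ω) (hXi : ∀ n, Integrable (X n) μ)
    (hXi2 : ∀ n, Integrable (fun ω => X n ω ^ 2) μ) (hC : ∀ n, ∫ ω, X n ω ^ 2 ∂μ ≤ C)
    (hL : Tendsto (fun n => ∫ ω, X n ω ∂μ) atTop (𝓝 L))
    (hY : ∀ᵐ ω ∂μ, Tendsto (fun n => X n ω) atTop (𝓝 (Y ω))) (hYm : AEMeasurable Y μ) :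
    ∫⁻ ω, ENNReal.ofReal (Y ω) ∂μ = ENNReal.ofReal L := by
  have hY0 : ∀ᵐ ω ∂μ, 0 ≤ Y ω := by
    filter_upwards [hY] with ω hω
    exact ge_of_tendsto' hω fun n => hX0 n ω
  -- Truncation at `K` loses at most `C / K` in the mean, uniformly in `n`, because `X - min X K ≤ X
  -- ^ 2 / K`. Letting `n` and then `K` tend to infinity gives the claim.
  have hmin : ∀ K : ℝ, 0 < K → |L - ∫ ω, min (Y ω) K ∂μ| ≤ C / K := by
    intro K hK
    have h1 : Tendsto (fun n => ∫ ω, min (X n ω) K ∂μ) atTop (𝓝 (∫ ω, min (Y ω) K ∂μ)) := by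
      refine tendsto_integral_of_dominated_convergence (fun _ => K)
        (fun n => ((hX n).min measurable_const).aestronglyMeasurable) (integrable_const K)
        (fun n => .of_forall fun ω => ?_) ?_
      · rw [Real.norm_of_nonneg (le_min (hX0 n ω) hK.le)]
        exact min_le_right _ _
      · filter_upwards [hY] with ω hω
        exact hω.min tendsto_const_nhds
    refine le_of_tendsto (hL.sub h1).abs (.of_forall fun n => ?_)
    have hmi : Integrable (fun ω => min (X n ω) K) μ :=
      (hXi n).inf (integrable_const K)
    rw [← integral_sub (hXi n) hmi, abs_of_nonneg
      (integral_nonneg fun ω => sub_nonneg.2 (min_le_left _ _))]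
    calc ∫ ω, X n ω - min (X n ω) K ∂μ ≤ ∫ ω, X n ω ^ 2 / K ∂μ := by
          refine integral_mono ((hXi n).sub hmi) ((hXi2 n).div_const K) fun ω => ?_
          have := hX0 n ω
          simp only
          rcases le_total (X n ω) K with h | h
          · rw [min_eq_left h, sub_self]
            positivity
          · rw [min_eq_right h, le_div_iff₀ hK]
            nlinarith
      _ = (∫ ω, X n ω ^ 2 ∂μ) / K := integral_div _ _
      _ ≤ C / K := by gcongr; exact hC n
  have hlim : Tendsto (fun k : ℕ => ∫ ω, min (Y ω) (k + 1 : ℝ) ∂μ) atTop (𝓝 L) := by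
    rw [tendsto_iff_norm_sub_tendsto_zero]
    refine squeeze_zero (g := fun k : ℕ => C / (k + 1 : ℝ)) (fun _ => norm_nonneg _) (fun k => ?_)
      (tendsto_const_div_atTop_nhds_zero_nat C |>.comp (tendsto_add_atTop_nat 1) |>.congr
        fun k => by simp)
    rw [norm_sub_rev]
    exact hmin _ (by positivity)
  have hmono : Tendsto (fun k : ℕ => ∫⁻ ω, ENNReal.ofReal (min (Y ω) (k + 1 : ℝ)) ∂μ) atTop
      (𝓝 (∫⁻ ω, ENNReal.ofReal (Y ω) ∂μ)) := by
    refine lintegral_tendsto_of_tendsto_of_monotone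
      (fun k => (hYm.min aemeasurable_const).ennreal_ofReal) (.of_forall fun ω => ?_)
      (.of_forall fun ω => ?_)
    · intro m n h
      simp only
      gcongr
    · refine (ENNReal.continuous_ofReal.tendsto _).comp (tendsto_const_nhds.congr' ?_)
      obtain ⟨K, hK⟩ := exists_nat_ge (Y ω)
      filter_upwards [eventually_ge_atTop K] with k hk
      have : (K : ℝ) ≤ k := by exact_mod_cast hk
      rw [min_eq_left (by linarith)]
  refine tendsto_nhds_unique hmono
    (((ENNReal.continuous_ofReal.tendsto L).comp hlim).congr fun k => ?_)
  have hnn : ∀ᵐ ω ∂μ, 0 ≤ min (Y ω) (k + 1 : ℝ) := by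
    filter_upwards [hY0] with ω h
    exact le_min h (by positivity)
  rw [Function.comp_apply, ofReal_integral_eq_lintegral_ofReal _ hnn]
  refine Integrable.of_bound (hYm.min aemeasurable_const).aestronglyMeasurable (k + 1 : ℝ) ?_
  filter_upwards [hnn] with ω h
  rw [Real.norm_of_nonneg h]
  exact min_le_right _ _

/-! ### The limiting weight of a subtree and its moments. -/

section Weight

variable {Ω : Type*} {w : ℕ → Ω → ℕ} {a : ℝ} {i : ℕ}

/-- The limit of the rescaled sizes of the subtree of `i`. -/
noncomputable def subtreeWeight (w : ℕ → Ω → ℕ) (a : ℝ) (i : ℕ) (ω : Ω) : ℝ :=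
  limsup (fun N : ℕ => (N : ℝ) ^ (-a) * (subtreeSize (fun k => w k ω) i N : ℝ)) atTop

/-- Defining the weight as a `limsup` avoids exceptional null sets, so it is genuinely measurable
for the parents of vertices after `i`. -/
theorem measurable_subtreeWeight (hlt : ∀ j ω, 1 ≤ j → w j ω < j) (hi : 1 ≤ i) :
    Measurable[parentSigma w (Set.Ioi i)] (subtreeWeight w a i) := by
  refine Measurable.limsup fun N => ?_
  refine Measurable.const_mul ?_ _
  refine Measurable.comp (g := fun n : ℕ => (n : ℝ)) (measurable_of_countable _) ?_
  exact Measurable.mono (measurable_subtreeSize hlt hi N) (parentSigma_mono fun k hk => hk.1) le_rfl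

variable [MeasurableSpace Ω] {μ : Measure Ω}

theorem IsRandomForest.measurable_subtreeWeight (hw : IsRandomForest μ w a) (hi : 1 ≤ i) :
    Measurable (subtreeWeight w a i) :=
  (RecursiveTreeDestruction.measurable_subtreeWeight hw.lt hi).mono
    (parentSigma_le hw.measurable) le_rfl

variable [IsProbabilityMeasure μ]

/-- For `p = 1` the normalized size is a nonnegative martingale of mean one, hence converges almost
surely; `tendsto_growth` turns its normalization into a power of `N`. -/
theorem IsRandomForest.ae_tendsto_subtreeSize (hw : IsRandomForest μ w a) (ha : 0 ≤ a)
    (hi : 1 ≤ i) :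
    ∀ᵐ ω ∂μ, Tendsto (fun N : ℕ => (N : ℝ) ^ (-a) * (subtreeSize (fun k => w k ω) i N : ℝ)) atTop
      (𝓝 (subtreeWeight w a i ω)) := by
  have hM := hw.martingale_risingSize ha hi 1
  have hbdd : ∀ m, eLpNorm (fun ω => risingSize w i 1 (i + m) ω / growth (a * (1 : ℕ)) i m) 1 μ
      ≤ (1 : NNReal) := by
    intro m
    have hg : 0 < growth (a * (1 : ℕ)) i m := growth_pos (by positivity) i m
    rw [eLpNorm_one_eq_lintegral_enorm, ← ofReal_integral_norm_eq_lintegral_enorm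
      (hM.integrable m)]
    have : ∀ ω, ‖risingSize w i 1 (i + m) ω / growth (a * (1 : ℕ)) i m‖ =
        risingSize w i 1 (i + m) ω / growth (a * (1 : ℕ)) i m := fun ω =>
      Real.norm_of_nonneg (div_nonneg (risingSize_nonneg _ _ _) hg.le)
    simp_rw [this]
    rw [integral_div, hw.integral_risingSize hi, Nat.factorial_one, Nat.cast_one, one_mul,
      div_self (by simpa using hg.ne')]
    simp
  filter_upwards [hM.submartingale.ae_tendsto_limitProcess hbdd] with ω hω
  have h := ((tendsto_growth (x := a * (1 : ℕ)) (by positivity) hi).mul hω).congr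
    (f₂ := fun m : ℕ => ((m + i : ℕ) : ℝ) ^ (-a) * (subtreeSize (fun k => w k ω) i (m + i) : ℝ))
    fun m => by
      have hg : 0 < growth (a * (1 : ℕ)) i m := growth_pos (by positivity) i m
      have : risingSize w i 1 (i + m) ω = (subtreeSize (fun k => w k ω) i (m + i) : ℝ) := by
        simp [risingSize, Nat.ascFactorial_succ, add_comm]
      rw [this, add_comm i m]
      simp only [Nat.cast_one, mul_one] at hg ⊢
      field_simp
  have h' := (tendsto_add_atTop_iff_nat (f := fun N : ℕ =>
    (N : ℝ) ^ (-a) * (subtreeSize (fun k => w k ω) i N : ℝ)) i).1 h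
  rw [subtreeWeight, h'.limsup_eq]
  exact h'

theorem IsRandomForest.subtreeWeight_nonneg (hw : IsRandomForest μ w a) (ha : 0 ≤ a)
    (hi : 1 ≤ i) : ∀ᵐ ω ∂μ, 0 ≤ subtreeWeight w a i ω := by
  filter_upwards [hw.ae_tendsto_subtreeSize ha hi] with ω hω
  exact ge_of_tendsto' hω fun N => by positivity

theorem IsRandomForest.lintegral_subtreeWeight_pow (hw : IsRandomForest μ w a) (ha : 0 < a)
    (hi : 1 ≤ i) (p : ℕ) :
    ∫⁻ ω, ENNReal.ofReal (subtreeWeight w a i ω ^ p) ∂μ =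
      ENNReal.ofReal (p.factorial * (Real.Gamma i / Real.Gamma (i + a * p))) := by
  set X : ℕ → ℕ → Ω → ℝ := fun p m ω =>
    ((i + m : ℕ) : ℝ) ^ (-(a * p)) * risingSize w i p (i + m) ω with hX
  have hXi : ∀ p m, Integrable (X p m) μ := fun p m =>
    (hw.integrable_risingSize hi p _).const_mul _
  have hX0 : ∀ p m ω, 0 ≤ X p m ω := fun p m ω =>
    mul_nonneg (by positivity) (risingSize_nonneg _ _ _)
  have hXm : ∀ p m, Measurable (X p m) := fun p m =>
    ((measurable_risingSize hw.lt hi p (i + m)).mono (parentSigma_le hw.measurable)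
      le_rfl).const_mul _
  have hlim : ∀ p, Tendsto (fun m => ∫ ω, X p m ω ∂μ) atTop
      (𝓝 (p.factorial * (Real.Gamma i / Real.Gamma (i + a * p)))) := by
    intro p
    refine ((tendsto_growth (x := a * p) (by positivity) hi).const_mul
      (p.factorial : ℝ)).congr fun m => ?_
    simp only [hX]
    rw [integral_const_mul, hw.integral_risingSize hi]
    ring
  obtain ⟨C, hC⟩ := (hlim (2 * p)).bddAbove_range
  -- The square of a rising factorial of length `p` is at most the one of length `2 * p`, whose
  -- rescaled means converge. This is the second moment bound.
  have hsq : ∀ m ω, X p m ω ^ 2 ≤ X (2 * p) m ω := by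
    intro m ω
    simp only [hX, mul_pow, risingSize]
    have him : (0 : ℝ) < ((i + m : ℕ) : ℝ) := by positivity
    have e : (((i + m : ℕ) : ℝ) ^ (-(a * p))) ^ 2 = ((i + m : ℕ) : ℝ) ^ (-(a * (2 * p : ℕ))) := by
      rw [← Real.rpow_mul_natCast him.le]
      congr 1
      push_cast
      ring
    rw [e]
    gcongr
    rw [two_mul, ← Nat.ascFactorial_mul_ascFactorial, sq]
    push_cast
    gcongr
    exact Nat.le_add_right _ _
  have hsqi : ∀ m, Integrable (fun ω => X p m ω ^ 2) μ := fun m =>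
    (hXi (2 * p) m).mono' ((hXm p m).pow_const 2).aestronglyMeasurable (.of_forall fun ω => by
      rw [Real.norm_of_nonneg (by positivity)]
      exact hsq m ω)
  refine lintegral_eq_of_tendsto_integral (hXm p) (hX0 p) (hXi p) hsqi (C := C) (fun m => ?_)
    (hlim p) ?_ ((hw.measurable_subtreeWeight hi).pow_const p).aemeasurable
  · exact (integral_mono (hsqi m) (hXi (2 * p) m) (hsq m)).trans (hC ⟨m, rfl⟩)
  · filter_upwards [hw.ae_tendsto_subtreeSize ha.le hi] with ω hω
    have hN : Tendsto (fun m : ℕ => i + m) atTop atTop :=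
      tendsto_atTop_mono (fun m => Nat.le_add_left m i) tendsto_id
    have h1 := hω.comp hN
    have h2 : Tendsto (fun m : ℕ => ((i + m : ℕ) : ℝ) ^ (-a)) atTop (𝓝 0) :=
      (tendsto_rpow_neg_atTop ha).comp (tendsto_natCast_atTop_atTop.comp hN)
    -- After rescaling, the shifts `j` in the rising factorial vanish, so it has the same limit as
    -- the `p`-th power.
    have h3 : Tendsto (fun m : ℕ => ∏ j ∈ Finset.range p, (((i + m : ℕ) : ℝ) ^ (-a) *
        (subtreeSize (fun k => w k ω) i (i + m) : ℝ) + ((i + m : ℕ) : ℝ) ^ (-a) * (j : ℝ))) atTop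
        (𝓝 (∏ j ∈ Finset.range p, (subtreeWeight w a i ω + 0 * (j : ℝ)))) :=
      tendsto_finsetProd _ fun j _ => h1.add (h2.mul_const _)
    simp only [zero_mul, add_zero, Finset.prod_const, Finset.card_range] at h3
    refine h3.congr fun m => ?_
    simp only [hX, risingSize, Nat.ascFactorial_eq_prod_range, ← mul_add]
    rw [Finset.prod_mul_distrib, Finset.prod_const, Finset.card_range,
      ← Real.rpow_mul_natCast (by positivity)]
    push_cast
    ring_nf

end Weight

/-! ### Gamma and exponential laws through their moments. -/

/-- Two laws with the same moments, and finite exponential moments near `0`, are equal. -/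
theorem measure_eq_of_moments {μ ν : Measure ℝ} [IsProbabilityMeasure μ] [IsProbabilityMeasure ν]
    (hμ : 0 ∈ interior (integrableExpSet id μ)) (hν : 0 ∈ interior (integrableExpSet id ν))
    (h : ∀ n : ℕ, ∫ x, x ^ n ∂μ = ∫ x, x ^ n ∂ν) : μ = ν := by
  -- The moments are the Taylor coefficients at `0`, so the moment generating functions agree near
  -- `0`. The identity theorem extends this to the strip `U`, whose imaginary axis carries the
  -- characteristic functions.
  have hser := hasFPowerSeriesAt_mgf hμ
  have hser' := hasFPowerSeriesAt_mgf hν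
  simp only [id, zero_mul, Real.exp_zero, mul_one, h] at hser hser'
  have hev : ∀ᶠ t : ℝ in 𝓝 0, mgf id μ t = mgf id ν t := by
    have h0 : HasFPowerSeriesAt (mgf id μ - mgf id ν)
        (0 : FormalMultilinearSeries ℝ ℝ ℝ) 0 := by
      have := hser.sub hser'
      rwa [sub_self] at this
    filter_upwards [h0.eventually_eq_zero] with t ht
    exact sub_eq_zero.1 ht
  set U : Set ℂ := {z | z.re ∈ interior (integrableExpSet id μ) ∩ interior (integrableExpSet id ν)}
  have hX : AnalyticOnNhd ℂ (complexMGF id μ) U :=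
    analyticOnNhd_complexMGF.mono fun z hz => hz.1
  have hY : AnalyticOnNhd ℂ (complexMGF id ν) U :=
    analyticOnNhd_complexMGF.mono fun z hz => hz.2
  have hpre : IsPreconnected U :=
    ((convex_integrableExpSet.interior.inter convex_integrableExpSet.interior).linear_preimage
      Complex.reLm).isPreconnected
  have hEq : Set.EqOn (complexMGF id μ) (complexMGF id ν) U := by
    refine hX.eqOn_of_preconnected_of_frequently_eq hY hpre (z₀ := ((0 : ℝ) : ℂ))
      (by simp only [U, Set.mem_ofPred_eq, Complex.ofReal_re]; exact ⟨hμ, hν⟩) ?_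
    have hfr : ∃ᶠ x : ℝ in 𝓝[≠] 0, complexMGF id μ x = complexMGF id ν x := by
      refine Eventually.frequently ?_
      filter_upwards [hev.filter_mono nhdsWithin_le_nhds] with t ht
      rw [complexMGF_ofReal, complexMGF_ofReal, ht]
    have hmap : Tendsto (fun x : ℝ => (x : ℂ)) (𝓝[≠] 0) (𝓝[≠] ((0 : ℝ) : ℂ)) := by
      refine tendsto_nhdsWithin_iff.2 ⟨(Complex.continuous_ofReal.tendsto 0).mono_left
        nhdsWithin_le_nhds, ?_⟩
      filter_upwards [self_mem_nhdsWithin] with x hx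
      simpa using hx
    exact hmap.frequently hfr
  refine Measure.ext_of_charFun (funext fun t => ?_)
  rw [← complexMGF_id_mul_I, ← complexMGF_id_mul_I]
  refine hEq ?_
  simp only [U, Set.mem_ofPred_eq, Complex.mul_I_re, Complex.ofReal_im, neg_zero]
  exact ⟨hμ, hν⟩

theorem lintegral_exp_mul_of_moments {μ : Measure ℝ} (h0 : ∀ᵐ x ∂μ, 0 ≤ x)
    (h : ∀ n : ℕ, ∫⁻ x, ENNReal.ofReal (x ^ n) ∂μ = n.factorial) {r : ℝ} (hr : 0 ≤ r) :
    ∫⁻ x, ENNReal.ofReal (Real.exp (r * x)) ∂μ = ∑' n : ℕ, ENNReal.ofReal r ^ n := by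
  have e : ∀ᵐ x ∂μ, ENNReal.ofReal (Real.exp (r * x)) =
      ∑' n : ℕ, ENNReal.ofReal (r ^ n / n.factorial) * ENNReal.ofReal (x ^ n) := by
    filter_upwards [h0] with x hx
    have hs := NormedSpace.expSeries_div_hasSum_exp (𝔸 := ℝ) (r * x)
    rw [← Real.exp_eq_exp_ℝ] at hs
    rw [← hs.tsum_eq, ENNReal.ofReal_tsum_of_nonneg (fun n => by positivity) hs.summable]
    refine tsum_congr fun n => ?_
    rw [← ENNReal.ofReal_mul (by positivity), mul_pow]
    congr 1
    ring
  rw [lintegral_congr_ae e, lintegral_tsum fun n => by fun_prop]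
  refine tsum_congr fun n => ?_
  rw [lintegral_const_mul _ (by fun_prop), h, ← ENNReal.ofReal_natCast,
    ← ENNReal.ofReal_mul (by positivity), div_mul_cancel₀ _ (by positivity),
    ENNReal.ofReal_pow hr]

/-- With moments `n!` the exponential series integrates to the geometric series in `r`, finite for
`r < 1`; for `r ≤ 0` the integrand is bounded by one. -/
theorem zero_mem_interior_integrableExpSet {μ : Measure ℝ} [IsProbabilityMeasure μ]
    (h0 : ∀ᵐ x ∂μ, 0 ≤ x)
    (h : ∀ n : ℕ, ∫⁻ x, ENNReal.ofReal (x ^ n) ∂μ = n.factorial) :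
    0 ∈ interior (integrableExpSet id μ) := by
  refine mem_interior.2 ⟨Set.Iio 1, fun r hr => ?_, isOpen_Iio, by simp⟩
  have key : ∀ r : ℝ, 0 ≤ r → r < 1 → Integrable (fun x => Real.exp (r * x)) μ := by
    intro r hr0 hr1
    refine ⟨by fun_prop, ?_⟩
    rw [hasFiniteIntegral_iff_ofReal (.of_forall fun x => (Real.exp_pos _).le),
      lintegral_exp_mul_of_moments h0 h hr0, ENNReal.tsum_geometric, ENNReal.inv_lt_top,
      tsub_pos_iff_lt, ← ENNReal.ofReal_one]
    exact (ENNReal.ofReal_lt_ofReal_iff one_pos).2 hr1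
  simp only [integrableExpSet, Set.mem_ofPred_eq, id]
  rcases le_total 0 r with hr0 | hr0
  · exact key r hr0 hr
  · refine (integrable_const (1 : ℝ)).mono' (by fun_prop) ?_
    filter_upwards [h0] with x hx
    rw [Real.norm_of_nonneg (Real.exp_pos _).le, Real.exp_le_one_iff]
    exact mul_nonpos_of_nonpos_of_nonneg hr0 hx

theorem integral_pow_of_moments {μ : Measure ℝ} (h0 : ∀ᵐ x ∂μ, 0 ≤ x)
    (h : ∀ n : ℕ, ∫⁻ x, ENNReal.ofReal (x ^ n) ∂μ = n.factorial) (n : ℕ) :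
    ∫ x, x ^ n ∂μ = n.factorial := by
  rw [integral_eq_lintegral_of_nonneg_ae _ (by fun_prop), h]
  · simp
  · filter_upwards [h0] with x hx
    exact pow_nonneg hx n

theorem measurable_gammaPDF (b r : ℝ) : Measurable (gammaPDF b r) :=
  (measurable_gammaPDFReal b r).ennreal_ofReal

/-- The moments of the gamma distribution. -/
theorem lintegral_rpow_gammaMeasure {b r s : ℝ} (hb : 0 < b) (hr : 0 < r) (hs : 0 ≤ s) :
    ∫⁻ x, ENNReal.ofReal (x ^ s) ∂(gammaMeasure b r) =
      ENNReal.ofReal (Real.Gamma (b + s) / Real.Gamma b / r ^ s) := by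
  have hGb := Real.Gamma_pos_of_pos hb
  have hGs := Real.Gamma_pos_of_pos (add_pos_of_pos_of_nonneg hb hs)
  rw [gammaMeasure, lintegral_withDensity_eq_lintegral_mul _
    (measurable_gammaPDF b r) (by fun_prop)]
  -- Multiplying the density by `x ^ s` shifts the shape from `b` to `b + s`, up to a constant. The
  -- point `0` is set aside because powers do not add there.
  have e : ∀ᵐ x : ℝ, (gammaPDF b r * fun x => ENNReal.ofReal (x ^ s)) x =
      ENNReal.ofReal (Real.Gamma (b + s) / Real.Gamma b / r ^ s) * gammaPDF (b + s) r x := by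
    filter_upwards [measure_eq_zero_iff_ae_notMem.1 (measure_singleton (μ := volume) (0 : ℝ))]
      with x hx0
    rcases lt_or_gt_of_ne hx0 with hx | hx
    · simp [gammaPDF_of_neg hx]
    · rw [Pi.mul_apply, gammaPDF_of_nonneg hx.le, gammaPDF_of_nonneg hx.le,
        ← ENNReal.ofReal_mul (by positivity), ← ENNReal.ofReal_mul (by positivity),
        show b + s - 1 = (b - 1) + s by ring, Real.rpow_add hx, Real.rpow_add hr]
      congr 1
      have := Real.rpow_pos_of_pos hr s
      field_simp
  rw [lintegral_congr_ae e, lintegral_const_mul _ (measurable_gammaPDF _ r),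
    lintegral_gammaPDF_eq_one (by positivity) hr, mul_one]

theorem gammaMeasure_pos {b r : ℝ} : ∀ᵐ x ∂(gammaMeasure b r), 0 < x := by
  rw [gammaMeasure, ae_withDensity_iff (measurable_gammaPDF b r)]
  filter_upwards [measure_eq_zero_iff_ae_notMem.1 (measure_singleton (μ := volume) (0 : ℝ))]
    with x hx0 hx
  by_contra hneg
  exact hx (gammaPDF_of_neg (lt_of_le_of_ne (not_lt.1 hneg) hx0))

/-- The exponential distribution is determined by its moments. -/
theorem eq_expMeasure_of_moments {μ : Measure ℝ} [IsProbabilityMeasure μ]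
    (h0 : ∀ᵐ x ∂μ, 0 ≤ x)
    (h : ∀ n : ℕ, ∫⁻ x, ENNReal.ofReal (x ^ n) ∂μ = n.factorial) : μ = expMeasure 1 := by
  have := isProbabilityMeasure_expMeasure one_pos
  have h0' : ∀ᵐ x ∂(expMeasure 1), 0 ≤ x := gammaMeasure_pos.mono fun x hx => hx.le
  have h' : ∀ n : ℕ, ∫⁻ x, ENNReal.ofReal (x ^ n) ∂(expMeasure 1) = n.factorial := by
    intro n
    have := lintegral_rpow_gammaMeasure one_pos one_pos n.cast_nonneg
    simp only [Real.rpow_natCast] at this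
    rw [expMeasure, this, add_comm, Real.Gamma_nat_eq_factorial]
    simp
  exact measure_eq_of_moments (zero_mem_interior_integrableExpSet h0 h)
    (zero_mem_interior_integrableExpSet h0' h')
    fun n => by rw [integral_pow_of_moments h0 h, integral_pow_of_moments h0' h']

/-- If the moments of `ν` are `p! Γ(b) / Γ(b + a p)`, and `G` is an independent gamma variable of
shape `b` and rate `r`, then the product of `ν` and `(r G) ^ a` is standard exponential. -/
theorem map_gamma_rpow_mul {ν : Measure ℝ} [IsProbabilityMeasure ν] {a b r : ℝ} (ha : 0 < a)
    (hb : 0 < b) (hr : 0 < r) (h0 : ∀ᵐ x ∂ν, 0 ≤ x)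
    (h : ∀ p : ℕ, ∫⁻ x, ENNReal.ofReal (x ^ p) ∂ν =
      ENNReal.ofReal (p.factorial * (Real.Gamma b / Real.Gamma (b + a * p)))) :
    ((gammaMeasure b r).prod ν).map (fun z => (r * z.1) ^ a * z.2) = expMeasure 1 := by
  have := isProbabilityMeasure_gammaMeasure hb hr
  have hm : Measurable fun z : ℝ × ℝ => (r * z.1) ^ a * z.2 := by fun_prop
  have := Measure.isProbabilityMeasure_map (μ := (gammaMeasure b r).prod ν) hm.aemeasurable
  have hf : ∀ᵐ z ∂((gammaMeasure b r).prod ν), 0 < z.1 :=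
    Measure.quasiMeasurePreserving_fst.ae gammaMeasure_pos
  have hs : ∀ᵐ z ∂((gammaMeasure b r).prod ν), 0 ≤ z.2 :=
    Measure.quasiMeasurePreserving_snd.ae h0
  refine eq_expMeasure_of_moments ?_ fun p => ?_
  · rw [ae_map_iff hm.aemeasurable measurableSet_Ici]
    filter_upwards [hf, hs] with z h1 h2
    exact mul_nonneg (by positivity) h2
  · rw [lintegral_map (by fun_prop) hm]
    have e : ∀ᵐ z ∂((gammaMeasure b r).prod ν), ENNReal.ofReal (((r * z.1) ^ a * z.2) ^ p) =
        (ENNReal.ofReal (r ^ (a * p)) * ENNReal.ofReal (z.1 ^ (a * p))) *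
          ENNReal.ofReal (z.2 ^ p) := by
      filter_upwards [hf, hs] with z h1 h2
      rw [← ENNReal.ofReal_mul (by positivity), ← ENNReal.ofReal_mul (by positivity), mul_pow,
        ← Real.rpow_mul_natCast (by positivity), Real.mul_rpow hr.le h1.le]
    -- By independence the moments multiply: the gamma moment of order `a * p` cancels the Gamma
    -- quotient in `h` and the power of `r`, leaving `p!`.
    rw [lintegral_congr_ae e, lintegral_prod_mul (f := fun x =>
      ENNReal.ofReal (r ^ (a * p)) * ENNReal.ofReal (x ^ (a * p)))
      (g := fun y => ENNReal.ofReal (y ^ p)) (by fun_prop) (by fun_prop),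
      lintegral_const_mul _ (by fun_prop), lintegral_rpow_gammaMeasure hb hr (by positivity), h,
      ← ENNReal.ofReal_mul (by positivity)]
    have hGb := Real.Gamma_pos_of_pos hb
    have hGs := Real.Gamma_pos_of_pos (show 0 < b + a * p by positivity)
    have := Real.rpow_pos_of_pos hr (a * p)
    rw [← ENNReal.ofReal_mul (by positivity), ← ENNReal.ofReal_natCast]
    congr 1
    field_simp

/-! ### Quantitative approximation by the exponential law for large shape. -/

theorem abs_one_sub_rpow_le {a v : ℝ} (ha : 0 < a) (ha1 : a ≤ 1) (hv : 0 ≤ v) :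
    |1 - v ^ a| ≤ |1 - v| := by
  rcases le_total v 1 with h | h
  · have h1 : v ≤ v ^ a := Real.self_le_rpow_of_le_one hv h ha1
    have h2 : v ^ a ≤ 1 := Real.rpow_le_one hv h ha.le
    rw [abs_of_nonneg (by linarith), abs_of_nonneg (by linarith)]
    linarith
  · have h1 : v ^ a ≤ v := Real.rpow_le_self_of_one_le h ha1
    have h2 : 1 ≤ v ^ a := Real.one_le_rpow h ha.le
    rw [abs_of_nonpos (by linarith), abs_of_nonpos (by linarith)]
    linarith

/-- A bound on the distance of `x ^ a` from `b ^ a`, in terms of the squared distance of `x`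
from `b`. -/
theorem abs_rpow_sub_rpow_le {a b x : ℝ} (ha : 0 < a) (ha1 : a ≤ 1) (hb : 0 < b) (hx : 0 ≤ x) :
    |b ^ a - x ^ a| ≤ b ^ a * ((Real.sqrt b)⁻¹ * (1 + (x - b) ^ 2 / b)) := by
  have hsb := Real.sqrt_pos.2 hb
  have hss := Real.sq_sqrt hb.le
  have e : b ^ a - x ^ a = b ^ a * (1 - (x / b) ^ a) := by
    rw [Real.div_rpow hx hb.le]
    have := Real.rpow_pos_of_pos hb a
    field_simp
  rw [e, abs_mul, abs_of_pos (Real.rpow_pos_of_pos hb a)]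
  refine mul_le_mul_of_nonneg_left ((abs_one_sub_rpow_le ha ha1 (by positivity)).trans ?_)
    (by positivity)
  set s := Real.sqrt b
  rw [← hss, show 1 - x / s ^ 2 = s⁻¹ * ((s ^ 2 - x) / s) by field_simp, abs_mul,
    abs_of_pos (inv_pos.2 hsb)]
  refine mul_le_mul_of_nonneg_left ?_ (by positivity)
  have e2 : (x - s ^ 2) ^ 2 / s ^ 2 = |(s ^ 2 - x) / s| ^ 2 := by
    rw [sq_abs]
    field_simp
    ring
  rw [e2]
  -- With `y = |(s ^ 2 - x) / s|` this is `y ≤ 1 + y ^ 2`.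
  nlinarith [sq_nonneg (|(s ^ 2 - x) / s| - 1), sq_nonneg (|(s ^ 2 - x) / s|)]

/-- Bounds the mean of the rescaled weight uniformly in `b`. Log-convexity of Gamma is applied to `b
+ 1`, which is the mean of `b + a` and `b + a + 1` with weights `a` and `1 - a`; the constant comes
from `b + a ≤ 2 * b`. -/
theorem rpow_mul_Gamma_div_le {a b : ℝ} (ha : 0 < a) (ha1 : a ≤ 1) (hb : 1 ≤ b) :
    b ^ a * (Real.Gamma b / Real.Gamma (b + a)) ≤ 2 := by
  have hb0 : 0 < b := by linarith
  have hG := Real.Gamma_pos_of_pos hb0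
  have hGa := Real.Gamma_pos_of_pos (show 0 < b + a by linarith)
  have h1 : Real.Gamma (b + 1) ≤ Real.Gamma (b + a) * (b + a) ^ (1 - a) := by
    rcases ha1.eq_or_lt with rfl | ha1
    · simp
    have := Real.Gamma_mul_add_mul_le_rpow_Gamma_mul_rpow_Gamma (s := b + a) (t := b + a + 1)
      (by linarith) (by linarith) ha (sub_pos.2 ha1) (by ring)
    rw [show a * (b + a) + (1 - a) * (b + a + 1) = b + 1 by ring,
      Real.Gamma_add_one (s := b + a) (by linarith), Real.mul_rpow (by linarith) hGa.le] at this
    refine this.trans_eq ?_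
    rw [mul_left_comm, ← Real.rpow_add hGa]
    simp [mul_comm]
  rw [Real.Gamma_add_one hb0.ne'] at h1
  have h2 : (b + a) ^ (1 - a) ≤ 2 * b ^ (1 - a) := by
    calc (b + a) ^ (1 - a) ≤ (2 * b) ^ (1 - a) :=
          Real.rpow_le_rpow (by linarith) (by linarith) (by linarith)
      _ = 2 ^ (1 - a) * b ^ (1 - a) := Real.mul_rpow (by norm_num) hb0.le
      _ ≤ 2 * b ^ (1 - a) := by
          gcongr
          exact Real.rpow_le_self_of_one_le (by norm_num) (by linarith)
  have h3 : b ^ a * b ^ (1 - a) = b := by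
    rw [← Real.rpow_add hb0]
    simp
  have hba := Real.rpow_pos_of_pos hb0 a
  rw [← mul_div_assoc, div_le_iff₀ hGa]
  have h4 : b * Real.Gamma b ≤ Real.Gamma (b + a) * (2 * b ^ (1 - a)) :=
    h1.trans (mul_le_mul_of_nonneg_left h2 hGa.le)
  have h5 : b * (b ^ a * Real.Gamma b) ≤ b * (2 * Real.Gamma (b + a)) := by
    calc b * (b ^ a * Real.Gamma b) = b ^ a * (b * Real.Gamma b) := by ring
      _ ≤ b ^ a * (Real.Gamma (b + a) * (2 * b ^ (1 - a))) := by gcongr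
      _ = (b ^ a * b ^ (1 - a)) * (2 * Real.Gamma (b + a)) := by ring
      _ = _ := by rw [h3]
  exact le_of_mul_le_mul_left h5 hb0

theorem integrable_pow_gammaMeasure {b : ℝ} (hb : 0 < b) (n : ℕ) :
    Integrable (fun x => x ^ n) (gammaMeasure b 1) := by
  refine ⟨by fun_prop, ?_⟩
  rw [hasFiniteIntegral_iff_ofReal (gammaMeasure_pos.mono fun x hx => by positivity)]
  have := lintegral_rpow_gammaMeasure hb one_pos n.cast_nonneg
  simp only [Real.rpow_natCast] at this
  rw [this]
  exact ENNReal.ofReal_lt_top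

theorem integral_pow_gammaMeasure {b : ℝ} (hb : 0 < b) (n : ℕ) :
    ∫ x, x ^ n ∂(gammaMeasure b 1) = Real.Gamma (b + n) / Real.Gamma b := by
  rw [integral_eq_lintegral_of_nonneg_ae (gammaMeasure_pos.mono fun x hx => by positivity)
    (by fun_prop)]
  have := lintegral_rpow_gammaMeasure hb one_pos n.cast_nonneg
  simp only [Real.rpow_natCast] at this
  rw [this, ENNReal.toReal_ofReal]
  · simp
  · have := Real.Gamma_pos_of_pos hb
    have := Real.Gamma_pos_of_pos (show 0 < b + n by positivity)
    positivity

theorem integrable_sq_sub_gammaMeasure {b : ℝ} (hb : 0 < b) :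
    Integrable (fun x => (x - b) ^ 2) (gammaMeasure b 1) := by
  have := isProbabilityMeasure_gammaMeasure hb one_pos
  have h1 := integrable_pow_gammaMeasure hb 1
  have h2 := integrable_pow_gammaMeasure hb 2
  refine ((h2.sub (h1.const_mul (2 * b))).add (integrable_const (b ^ 2))).congr
    (.of_forall fun x => ?_)
  simp only [Pi.add_apply, Pi.sub_apply]
  ring

/-- The variance of the gamma distribution of shape `b`. -/
theorem integral_sq_sub_gammaMeasure {b : ℝ} (hb : 0 < b) :
    ∫ x, (x - b) ^ 2 ∂(gammaMeasure b 1) = b := by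
  have := isProbabilityMeasure_gammaMeasure hb one_pos
  have h1 := integrable_pow_gammaMeasure hb 1
  have h2 := integrable_pow_gammaMeasure hb 2
  have hG := (Real.Gamma_pos_of_pos hb).ne'
  have e : ∀ x : ℝ, (x - b) ^ 2 = x ^ 2 - 2 * b * x ^ 1 + b ^ 2 := fun x => by ring
  simp_rw [e]
  have h3 : Integrable (fun x => x ^ 2 - 2 * b * x ^ 1) (gammaMeasure b 1) := h2.sub (h1.const_mul _)
  rw [integral_add h3 (integrable_const _), integral_sub h2 (h1.const_mul _),
    integral_const_mul, integral_pow_gammaMeasure hb, integral_pow_gammaMeasure hb]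
  have e2 : Real.Gamma (b + (2 : ℕ)) = (b + 1) * (b * Real.Gamma b) := by
    rw [← Real.Gamma_add_one hb.ne', ← Real.Gamma_add_one (by positivity)]
    congr 1
    push_cast
    ring
  rw [e2, Nat.cast_one, Real.Gamma_add_one hb.ne']
  simp
  field_simp
  ring

/-- A law with moments `p! Γ(b) / Γ(b + a p)`, rescaled by `b ^ a`, is close to exponential. -/
theorem abs_integral_rpow_mul_sub_le {ν : Measure ℝ} [IsProbabilityMeasure ν] {a b : ℝ}
    (ha : 0 < a) (ha1 : a ≤ 1) (hb : 1 ≤ b) (h0 : ∀ᵐ x ∂ν, 0 ≤ x)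
    (h : ∀ p : ℕ, ∫⁻ x, ENNReal.ofReal (x ^ p) ∂ν =
      ENNReal.ofReal (p.factorial * (Real.Gamma b / Real.Gamma (b + a * p))))
    {F : ℝ → ℝ} {M : ℝ} {K : NNReal} (hM : ∀ x, |F x| ≤ M) (hF : LipschitzWith K F) :
    |∫ y, F (b ^ a * y) ∂ν - ∫ x, F x ∂(expMeasure 1)| ≤ 4 * K / Real.sqrt b := by
  have hb0 : 0 < b := by linarith
  have := isProbabilityMeasure_gammaMeasure hb0 one_pos
  have hFm : Measurable F := hF.continuous.measurable
  have hG := Real.Gamma_pos_of_pos hb0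
  have hGa := Real.Gamma_pos_of_pos (show 0 < b + a by linarith)
  have hsb := Real.sqrt_pos.2 hb0
  have hmean : ∫⁻ x, ENNReal.ofReal x ∂ν =
      ENNReal.ofReal (Real.Gamma b / Real.Gamma (b + a)) := by
    simpa using h 1
  have hyi : Integrable (fun y : ℝ => y) ν := by
    refine ⟨by fun_prop, ?_⟩
    rw [hasFiniteIntegral_iff_ofReal h0, hmean]
    exact ENNReal.ofReal_lt_top
  have hy : ∫ y, y ∂ν = Real.Gamma b / Real.Gamma (b + a) := by
    rw [integral_eq_lintegral_of_nonneg_ae h0 (by fun_prop), hmean, ENNReal.toReal_ofReal]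
    positivity
  have hexp := map_gamma_rpow_mul ha hb0 one_pos h0 h
  simp only [one_mul] at hexp
  have hm : Measurable fun z : ℝ × ℝ => z.1 ^ a * z.2 := by fun_prop
  -- Coupling: the exponential variable is realized as `z.1 ^ a * z.2` with the same second factor
  -- as in `b ^ a * z.2`, so only `z.1 ^ a` and `b ^ a` must be compared.
  have e1 : ∫ x, F x ∂(expMeasure 1) =
      ∫ z, F (z.1 ^ a * z.2) ∂((gammaMeasure b 1).prod ν) := by
    rw [← hexp, integral_map hm.aemeasurable hFm.aestronglyMeasurable]
  have e2 : ∫ y, F (b ^ a * y) ∂ν = ∫ z, F (b ^ a * z.2) ∂((gammaMeasure b 1).prod ν) := by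
    rw [integral_fun_snd (fun y => F (b ^ a * y))]
    simp
  have i1 : Integrable (fun z : ℝ × ℝ => F (z.1 ^ a * z.2)) ((gammaMeasure b 1).prod ν) :=
    Integrable.of_bound (hFm.comp hm).aestronglyMeasurable M (.of_forall fun z => hM _)
  have i2 : Integrable (fun z : ℝ × ℝ => F (b ^ a * z.2)) ((gammaMeasure b 1).prod ν) :=
    Integrable.of_bound (hFm.comp (by fun_prop)).aestronglyMeasurable M (.of_forall fun z => hM _)
  -- Since the gamma variance is `b`, the factor `1 + (x - b) ^ 2 / b` has mean `2`. Together with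
  -- the bound `2` of `rpow_mul_Gamma_div_le` this yields the constant `4`.
  set φ : ℝ → ℝ := fun x => K * (b ^ a * ((Real.sqrt b)⁻¹ * (1 + (x - b) ^ 2 / b))) with hφ
  have hφi : Integrable φ (gammaMeasure b 1) :=
    ((((integrable_const 1).add ((integrable_sq_sub_gammaMeasure hb0).div_const b)).const_mul
      _).const_mul _).const_mul _
  have hφe : ∫ x, φ x ∂(gammaMeasure b 1) = K * (b ^ a * ((Real.sqrt b)⁻¹ * 2)) := by
    simp only [hφ]
    rw [integral_const_mul, integral_const_mul, integral_const_mul, integral_add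
      (integrable_const 1) ((integrable_sq_sub_gammaMeasure hb0).div_const b), integral_div,
      integral_sq_sub_gammaMeasure hb0, div_self hb0.ne']
    simp
    norm_num
  rw [e1, e2, ← integral_sub i2 i1]
  calc |∫ z, F (b ^ a * z.2) - F (z.1 ^ a * z.2) ∂((gammaMeasure b 1).prod ν)|
      ≤ ∫ z, |F (b ^ a * z.2) - F (z.1 ^ a * z.2)| ∂((gammaMeasure b 1).prod ν) :=
        abs_integral_le_integral_abs
    _ ≤ ∫ z, φ z.1 * z.2 ∂((gammaMeasure b 1).prod ν) := by
        refine integral_mono_ae (i2.sub i1).abs (hφi.mul_prod hyi) ?_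
        filter_upwards [Measure.quasiMeasurePreserving_fst.ae (gammaMeasure_pos (b := b) (r := 1)),
          Measure.quasiMeasurePreserving_snd.ae h0] with z h1 h2
        have := hF.dist_le_mul (b ^ a * z.2) (z.1 ^ a * z.2)
        rw [Real.dist_eq, Real.dist_eq, ← sub_mul, abs_mul, abs_of_nonneg h2] at this
        refine this.trans ?_
        rw [← mul_assoc]
        refine mul_le_mul_of_nonneg_right ?_ h2
        exact mul_le_mul_of_nonneg_left (abs_rpow_sub_rpow_le ha ha1 hb0 h1.le) K.2
    _ = K * (b ^ a * ((Real.sqrt b)⁻¹ * 2)) * (Real.Gamma b / Real.Gamma (b + a)) := by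
        rw [integral_prod_mul φ (fun y => y), hφe, hy]
    _ = (b ^ a * (Real.Gamma b / Real.Gamma (b + a))) * (2 * K / Real.sqrt b) := by
        field_simp
    _ ≤ 2 * (2 * K / Real.sqrt b) := by
        gcongr
        exact rpow_mul_Gamma_div_le ha ha1 hb
    _ = 4 * K / Real.sqrt b := by ring

/-! ### Law and positivity of the subtree weights. -/

section

variable {Ω : Type*} [MeasurableSpace Ω] {μ : Measure Ω} [IsProbabilityMeasure μ]
  {w : ℕ → Ω → ℕ} {a : ℝ} {i : ℕ}

theorem IsRandomForest.lintegral_map_subtreeWeight (hw : IsRandomForest μ w a) (ha : 0 < a)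
    (hi : 1 ≤ i) (p : ℕ) :
    ∫⁻ x, ENNReal.ofReal (x ^ p) ∂(μ.map (subtreeWeight w a i)) =
      ENNReal.ofReal (p.factorial * (Real.Gamma i / Real.Gamma (i + a * p))) := by
  rw [lintegral_map (by fun_prop) (hw.measurable_subtreeWeight hi),
    hw.lintegral_subtreeWeight_pow ha hi]

theorem IsRandomForest.map_subtreeWeight_nonneg (hw : IsRandomForest μ w a) (ha : 0 ≤ a)
    (hi : 1 ≤ i) : ∀ᵐ x ∂(μ.map (subtreeWeight w a i)), 0 ≤ x := by
  rw [ae_map_iff (hw.measurable_subtreeWeight hi).aemeasurable measurableSet_Ici]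
  exact hw.subtreeWeight_nonneg ha hi

/-- A gamma power times an independent copy of the weight is exponential, hence almost surely
positive. By Fubini this holds for one fixed value of the gamma factor, which excludes a zero
weight. -/
theorem IsRandomForest.subtreeWeight_pos (hw : IsRandomForest μ w a) (ha : 0 < a)
    (hi : 1 ≤ i) : ∀ᵐ ω ∂μ, 0 < subtreeWeight w a i ω := by
  have hi0 : (0 : ℝ) < i := by exact_mod_cast hi
  have hm := hw.measurable_subtreeWeight hi
  have := isProbabilityMeasure_gammaMeasure hi0 one_pos
  have := Measure.isProbabilityMeasure_map (μ := μ) hm.aemeasurable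
  have hexp := map_gamma_rpow_mul ha hi0 one_pos (hw.map_subtreeWeight_nonneg ha.le hi)
    (hw.lintegral_map_subtreeWeight ha hi)
  have hpos : ∀ᵐ x ∂(expMeasure 1), 0 < x := gammaMeasure_pos
  rw [← hexp] at hpos
  have h1 := Measure.ae_ae_of_ae_prod (ae_of_ae_map (by fun_prop) hpos)
  obtain ⟨x, hx⟩ := h1.exists
  filter_upwards [ae_of_ae_map hm.aemeasurable hx, hw.subtreeWeight_nonneg ha.le hi] with ω h1 h2
  refine lt_of_le_of_ne h2 fun h3 => ?_
  simp [← h3] at h1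

end

/-! ### The roots: counting, independence from later weights, and the limit law. -/

section Roots

variable {Ω : Type*} {w : ℕ → Ω → ℕ} {a : ℝ} {n i j : ℕ}

theorem measurableSet_isRoot (hji : j ≤ i) :
    MeasurableSet[parentSigma w (Set.Iic i)] {ω | IsRoot (fun k => w k ω) j} := by
  unfold IsRoot
  rcases lt_or_ge j 2 with h | h
  · by_cases h1 : j = 1
    · simp [h1]
    · have : ∀ ω, ¬ (j = 1 ∨ (2 ≤ j ∧ w j ω = 0)) := by omega
      simp [this]
  · have : {ω | j = 1 ∨ (2 ≤ j ∧ w j ω = 0)} = w j ⁻¹' {0} := by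
      ext ω
      simp only [Set.mem_ofPred_eq, Set.mem_preimage, Set.mem_singleton_iff]
      omega
    rw [this]
    exact measurable_parent_parentSigma (S := Set.Iic i) h hji (MeasurableSet.singleton 0)

open Classical in
/-- The number of roots among the vertices smaller than `j`. -/
noncomputable def rootCount (w : ℕ → ℕ) (j : ℕ) : ℕ := Nat.count (IsRoot w) j

theorem measurable_rootCount (hji : j ≤ i + 1) :
    Measurable[parentSigma w (Set.Iic i)] fun ω => rootCount (fun k => w k ω) j := by
  classical
  unfold rootCount
  induction j with
  | zero =>
    simp only [Nat.count_zero]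
    exact @measurable_const _ _ _ (parentSigma w _) _
  | succ j ih =>
    simp_rw [Nat.count_succ]
    exact Measurable.add (ih (by omega)) (Measurable.ite (measurableSet_isRoot (by omega))
      (@measurable_const _ _ _ (parentSigma w _) _) (@measurable_const _ _ _ (parentSigma w _) _))

/-- The `n`-th root (`n = 1, 2, …`). -/
noncomputable def nthRoot (w : ℕ → ℕ) (n : ℕ) : ℕ := Nat.nth (IsRoot w) (n - 1)

/-- The event that `i` is the `n`-th root. -/
def nthRootEvent (w : ℕ → Ω → ℕ) (n i : ℕ) : Set Ω :=
  {ω | IsRoot (fun k => w k ω) i ∧ rootCount (fun k => w k ω) i = n - 1}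

theorem measurableSet_nthRootEvent :
    MeasurableSet[parentSigma w (Set.Iic i)] (nthRootEvent w n i) :=
  MeasurableSet.inter (measurableSet_isRoot le_rfl)
    (measurable_rootCount (by omega) (MeasurableSet.singleton (n - 1)))

theorem nthRoot_eq_of_mem {ω : Ω} (h : ω ∈ nthRootEvent w n i) :
    nthRoot (fun k => w k ω) n = i := by
  classical
  rw [nthRoot, ← h.2, rootCount, Nat.nth_count h.1]

theorem mem_nthRootEvent {ω : Ω} (h : {j | IsRoot (fun k => w k ω) j}.Infinite) :
    ω ∈ nthRootEvent w n (nthRoot (fun k => w k ω) n) := by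
  classical
  exact ⟨Nat.nth_mem_of_infinite h _, Nat.count_nth_of_infinite h _⟩

theorem IsRoot.one_le {w : ℕ → ℕ} (h : IsRoot w j) : 1 ≤ j := by
  rcases h with h | h <;> omega

theorem le_of_mem_nthRootEvent {ω : Ω} (h : ω ∈ nthRootEvent w n i) : n ≤ i := by
  classical
  have h1 := h.1.one_le
  obtain ⟨k, rfl⟩ := Nat.exists_eq_add_of_le' h1
  have h2 : rootCount (fun k => w k ω) (k + 1) ≤ k := by
    -- `Nat.count` also inspects `0`; as it is no root, at most `k` roots lie below `k + 1`.
    have h0 : ¬ IsRoot (fun k => w k ω) 0 := fun h => absurd h.one_le (by omega)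
    rw [rootCount, Nat.count_succ', if_neg h0, add_zero]
    exact Nat.count_le _
  have := h.2
  omega

theorem disjoint_nthRootEvent : Pairwise (Function.onFun Disjoint (nthRootEvent w n)) := by
  intro i j hij
  refine Set.disjoint_left.2 fun ω hi hj => hij ?_
  rw [← nthRoot_eq_of_mem hi, nthRoot_eq_of_mem hj]

variable [MeasurableSpace Ω] {μ : Measure Ω}

/-- The `n`-th root and the weights of subtrees of later vertices are independent. -/
theorem IsRandomForest.setIntegral_nthRootEvent (hw : IsRandomForest μ w a) {f : ℝ → ℝ}
    (hf : Measurable f) (n i : ℕ) :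
    ∫ ω in nthRootEvent w n i, f (subtreeWeight w a i ω) ∂μ =
      μ.real (nthRootEvent w n i) * ∫ ω, f (subtreeWeight w a i ω) ∂μ := by
  rcases Nat.eq_zero_or_pos i with rfl | hi
  · have : nthRootEvent w n 0 = ∅ := Set.eq_empty_of_forall_notMem fun ω h =>
      absurd h.1.one_le (by omega)
    simp [this]
  have hB : MeasurableSet[parentSigma w (Set.Iic i)] (nthRootEvent w n i) :=
    measurableSet_nthRootEvent
  have hB' := parentSigma_le hw.measurable _ hB
  have hBm : Measurable[parentSigma w (Set.Iic i)]
      ((nthRootEvent w n i).indicator (fun _ => (1 : ℝ))) :=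
    Measurable.indicator (@measurable_const _ _ _ (parentSigma w _) _) hB
  have hW : Measurable[parentSigma w (Set.Ioi i)] fun ω => f (subtreeWeight w a i ω) :=
    Measurable.comp hf (RecursiveTreeDestruction.measurable_subtreeWeight hw.lt hi)
  have hind : IndepFun ((nthRootEvent w n i).indicator (fun _ => (1 : ℝ)))
      (fun ω => f (subtreeWeight w a i ω)) μ := by
    rw [IndepFun_iff_Indep]
    refine indep_of_indep_of_le_left (indep_of_indep_of_le_right
      (hw.indep_parentSigma (S := Set.Iic i) (T := Set.Ioi i) ?_) hW.comap_le) hBm.comap_le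
    exact Set.disjoint_left.2 fun k (h1 : k ≤ i) (h2 : i < k) => absurd h2 (not_lt.2 h1)
  have := hind.integral_fun_mul_eq_mul_integral
    (hBm.mono (parentSigma_le hw.measurable) le_rfl).aestronglyMeasurable
    (hW.mono (parentSigma_le hw.measurable) le_rfl).aestronglyMeasurable
  rw [integral_indicator hB', setIntegral_const, smul_eq_mul, mul_one] at this
  rw [← this, ← integral_indicator hB']
  refine integral_congr_ae (.of_forall fun ω => ?_)
  by_cases h : ω ∈ nthRootEvent w n i <;> simp [h]

variable [IsProbabilityMeasure μ]

/-- Strong law of large numbers for the independent root indicators of the vertices `k + 2`; vertex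
`1` is always a root and contributes the extra `1` in `hcount`. -/
theorem IsRandomForest.ae_tendsto_rootCount (hw : IsRandomForest μ w a) :
    ∀ᵐ ω ∂μ, Tendsto (fun N : ℕ => (rootCount (fun k => w k ω) N : ℝ) / N) atTop (𝓝 (1 - a)) := by
  classical
  set g : ℕ → ℝ := fun v => if v = 0 then 1 else 0 with hg
  have hgm : Measurable g := measurable_of_countable g
  set X : ℕ → Ω → ℝ := fun k ω => g (w (k + 2) ω) with hX
  have hXm : ∀ k, Measurable (X k) := fun k => hgm.comp (hw.measurable _)
  have hXind : ∀ k, X k = Set.indicator {ω | w (k + 2) ω = 0} (fun _ => (1 : ℝ)) := by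
    intro k
    ext ω
    simp [hX, hg, Set.indicator_apply]
  have hms : ∀ k, MeasurableSet {ω | w (k + 2) ω = 0} := fun k =>
    hw.measurable (k + 2) (MeasurableSet.singleton 0)
  have hint : Integrable (X 0) μ := by
    rw [hXind]
    exact (integrable_const 1).indicator (hms 0)
  have hmean : μ[X 0] = 1 - a := by
    rw [hXind, integral_indicator (hms 0), setIntegral_const, hw.prob_root _ (by omega)]
    simp
  have hindep : Pairwise (Function.onFun (fun f g => IndepFun f g μ) X) := by
    intro j k hjk
    exact (hw.indep.indepFun (i := ⟨j + 2, by omega⟩) (j := ⟨k + 2, by omega⟩)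
      (by simpa using hjk)).comp hgm hgm
  have hident : ∀ k, IdentDistrib (X k) (X 0) μ μ := by
    intro k
    refine ⟨(hXm k).aemeasurable, (hXm 0).aemeasurable, ?_⟩
    have hprob : ∀ k, μ {ω | w (k + 2) ω = 0} = ENNReal.ofReal (1 - a) := fun k => by
      rw [← hw.prob_root (k + 2) (by omega), ofReal_measureReal]
    have hcompl : ∀ k, μ {ω | w (k + 2) ω = 0}ᶜ = 1 - ENNReal.ofReal (1 - a) := fun k => by
      rw [prob_compl_eq_one_sub (hms k), hprob]
    ext A hA
    rw [Measure.map_apply (hXm k) hA, Measure.map_apply (hXm 0) hA, hXind, hXind,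
      Set.indicator_const_preimage_eq_union, Set.indicator_const_preimage_eq_union]
    by_cases h1 : (1 : ℝ) ∈ A <;> by_cases h0 : (0 : ℝ) ∈ A <;>
      simp [h0, h1, Set.union_compl_self, hprob, hcompl]
  filter_upwards [strong_law_ae_real X hint hindep hident] with ω hω
  rw [hmean] at hω
  have hcount : ∀ m : ℕ, (rootCount (fun k => w k ω) (m + 2) : ℝ) =
      1 + ∑ k ∈ Finset.range m, X k ω := by
    intro m
    induction m with
    | zero =>
      simp [rootCount, Nat.count_succ, IsRoot]
    | succ m ih =>
      rw [Finset.sum_range_succ, ← add_assoc, ← ih, rootCount, rootCount, Nat.count_succ]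
      simp [hX, hg, IsRoot]
  rw [← tendsto_add_atTop_iff_nat 2]
  have h1 : Tendsto (fun m : ℕ => (1 : ℝ) / ((m : ℝ) + 2)) atTop (𝓝 0) :=
    tendsto_const_nhds.div_atTop
      (tendsto_natCast_atTop_atTop.atTop_add tendsto_const_nhds)
  have h2 := tendsto_natCast_div_add_atTop (2 : ℝ)
  have h3 := h1.add (hω.mul h2)
  rw [zero_add, mul_one] at h3
  refine h3.congr' ?_
  filter_upwards [eventually_gt_atTop 0] with m hm
  have hm0 : (0 : ℝ) < m := by exact_mod_cast hm
  rw [hcount]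
  push_cast
  field_simp

theorem IsRandomForest.ae_infinite_roots (hw : IsRandomForest μ w a) (ha : a < 1) :
    ∀ᵐ ω ∂μ, {j | IsRoot (fun k => w k ω) j}.Infinite := by
  classical
  filter_upwards [hw.ae_tendsto_rootCount] with ω hω hfin
  have hb : ∀ N, rootCount (fun k => w k ω) N ≤ hfin.toFinset.card := by
    intro N
    rw [rootCount, Nat.count_eq_card_filter_range]
    refine Finset.card_le_card fun j hj => ?_
    simpa using (Finset.mem_filter.1 hj).2
  have h0 : Tendsto (fun N : ℕ => (rootCount (fun k => w k ω) N : ℝ) / N) atTop (𝓝 0) := by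
    refine squeeze_zero (fun _ => by positivity) (fun N => ?_)
      (tendsto_const_div_atTop_nhds_zero_nat (hfin.toFinset.card : ℝ))
    gcongr
    exact_mod_cast hb N
  have := tendsto_nhds_unique hω h0
  linarith

/-- The law of large numbers for `rootCount` is read along the roots themselves, where the count
equals `n - 1`. -/
theorem IsRandomForest.ae_tendsto_nthRoot (hw : IsRandomForest μ w a) (ha : a < 1) :
    ∀ᵐ ω ∂μ, Tendsto (fun n : ℕ => (n : ℝ) / nthRoot (fun k => w k ω) n) atTop (𝓝 (1 - a)) := by
  classical
  filter_upwards [hw.ae_tendsto_rootCount, hw.ae_infinite_roots ha] with ω hω hinf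
  have hge : ∀ n, n ≤ nthRoot (fun k => w k ω) n := fun n =>
    le_of_mem_nthRootEvent (mem_nthRootEvent hinf)
  have hR : Tendsto (nthRoot fun k => w k ω) atTop atTop := tendsto_atTop_mono hge tendsto_id
  have h1 := hω.comp hR
  have h2 : Tendsto (fun n : ℕ => 1 / (nthRoot (fun k => w k ω) n : ℝ)) atTop (𝓝 0) :=
    tendsto_const_nhds.div_atTop (tendsto_natCast_atTop_atTop.comp hR)
  have h3 := h1.add h2
  rw [add_zero] at h3
  refine h3.congr' ?_
  filter_upwards [eventually_ge_atTop 1] with n hn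
  have : rootCount (fun k => w k ω) (nthRoot (fun k => w k ω) n) = n - 1 :=
    (mem_nthRootEvent (n := n) hinf).2
  rw [Function.comp_apply, this, ← add_div]
  congr 1
  exact_mod_cast Nat.sub_add_cancel hn

/-- A family of measurable functions, evaluated at the `n`-th root. -/
theorem IsRandomForest.aemeasurable_nthRoot (hw : IsRandomForest μ w a) (ha : a < 1)
    {f : ℕ → Ω → ℝ} (hf : ∀ i, 1 ≤ i → Measurable (f i)) (n : ℕ) :
    AEMeasurable (fun ω => f (nthRoot (fun k => w k ω) n) ω) μ := by
  -- The sum over possible values `i ≤ N` of the `n`-th root is eventually constant in `N` whenever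
  -- there are infinitely many roots, which holds almost surely.
  refine aemeasurable_of_tendsto_metrizable_ae (u := atTop)
    (f := fun N : ℕ => fun ω => ∑ i ∈ Finset.Icc 1 N, (nthRootEvent w n i).indicator (f i) ω)
    (fun N => ?_) ?_
  · refine (Finset.measurable_fun_sum _ fun i hi => ?_).aemeasurable
    exact (hf i (Finset.mem_Icc.1 hi).1).indicator
      (parentSigma_le hw.measurable _ measurableSet_nthRootEvent)
  · filter_upwards [hw.ae_infinite_roots ha] with ω hω
    have hmem := mem_nthRootEvent (n := n) hω
    refine tendsto_const_nhds.congr' ?_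
    filter_upwards [eventually_ge_atTop (nthRoot (fun k => w k ω) n)] with N hN
    rw [Finset.sum_eq_single (nthRoot (fun k => w k ω) n), Set.indicator_of_mem hmem]
    · intro j _ hj
      exact Set.indicator_of_notMem (fun h => hj (nthRoot_eq_of_mem h).symm) _
    · intro h
      exact absurd (Finset.mem_Icc.2 ⟨hmem.1.one_le, hN⟩) h

/-- Decomposes over the value `i` of the `n`-th root. On each event the weight keeps its
unconditional law by independence, and `n ≤ i`, so an estimate uniform over fixed `i ≥ n` survives
averaging. -/
theorem IsRandomForest.abs_integral_nthRoot_sub_le (hw : IsRandomForest μ w a) (ha : a < 1)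
    {f : ℕ → ℝ → ℝ} {M c δ : ℝ} (hf : ∀ i, Measurable (f i)) (hM : ∀ i x, |f i x| ≤ M) {n : ℕ}
    (hδ : ∀ i, 1 ≤ i → n ≤ i → |∫ ω, f i (subtreeWeight w a i ω) ∂μ - c| ≤ δ) :
    |∫ ω, f (nthRoot (fun k => w k ω) n) (subtreeWeight w a (nthRoot (fun k => w k ω) n) ω) ∂μ - c|
      ≤ δ := by
  set g : Ω → ℝ := fun ω =>
    f (nthRoot (fun k => w k ω) n) (subtreeWeight w a (nthRoot (fun k => w k ω) n) ω) - c with hg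
  have hgi' : Integrable (fun ω => f (nthRoot (fun k => w k ω) n)
      (subtreeWeight w a (nthRoot (fun k => w k ω) n) ω)) μ :=
    Integrable.of_bound (hw.aemeasurable_nthRoot ha (f := fun i ω => f i (subtreeWeight w a i ω))
      (fun i hi => (hf i).comp (hw.measurable_subtreeWeight hi)) n).aestronglyMeasurable M
      (.of_forall fun ω => hM _ _)
  have hgi : Integrable g μ := hgi'.sub (integrable_const c)
  have hms : ∀ i, MeasurableSet (nthRootEvent w n i) := fun i =>
    parentSigma_le hw.measurable _ measurableSet_nthRootEvent
  have huniv : (⋃ i, nthRootEvent w n i) =ᵐ[μ] Set.univ := by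
    rw [ae_eq_univ]
    refine measure_mono_null ?_ (hw.ae_infinite_roots ha)
    intro ω hω hinf
    exact hω (Set.mem_iUnion.2 ⟨_, mem_nthRootEvent hinf⟩)
  have hsum : ∀ F : Ω → ℝ, Integrable F μ →
      HasSum (fun i => ∫ ω in nthRootEvent w n i, F ω ∂μ) (∫ ω, F ω ∂μ) := by
    intro F hF
    have := hasSum_integral_iUnion (μ := μ) hms disjoint_nthRootEvent hF.integrableOn
    rwa [setIntegral_congr_set huniv, setIntegral_univ] at this
  have h1 := hsum g hgi
  have h2 := hsum (fun _ => δ) (integrable_const δ)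
  have h3 : ∫ ω, g ω ∂μ = ∫ ω, f (nthRoot (fun k => w k ω) n)
      (subtreeWeight w a (nthRoot (fun k => w k ω) n) ω) ∂μ - c := by
    rw [integral_sub hgi' (integrable_const c)]
    simp
  rw [← h3, ← h1.tsum_eq, ← Real.norm_eq_abs]
  have h4 : ∫ _, δ ∂μ = δ := by simp
  rw [h4] at h2
  refine tsum_of_norm_bounded h2 fun i => ?_
  by_cases hemp : (nthRootEvent w n i).Nonempty
  · obtain ⟨ω₀, hω₀⟩ := hemp
    have hi : 1 ≤ i := hω₀.1.one_le
    have e : ∫ ω in nthRootEvent w n i, g ω ∂μ =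
        ∫ ω in nthRootEvent w n i, (fun x => f i x - c) (subtreeWeight w a i ω) ∂μ := by
      refine setIntegral_congr_fun (hms i) fun ω hω => ?_
      simp only [hg, nthRoot_eq_of_mem hω]
    rw [e, hw.setIntegral_nthRootEvent ((hf i).sub_const c), setIntegral_const, smul_eq_mul,
      norm_mul, Real.norm_of_nonneg measureReal_nonneg]
    refine mul_le_mul_of_nonneg_left ?_ measureReal_nonneg
    rw [integral_sub, Real.norm_eq_abs]
    · simpa using hδ i hi (le_of_mem_nthRootEvent hω₀)
    · exact Integrable.of_bound
        ((hf i).comp (hw.measurable_subtreeWeight hi)).aestronglyMeasurable M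
        (.of_forall fun ω => hM _ _)
    · exact integrable_const c
  · rw [Set.not_nonempty_iff_eq_empty.1 hemp]
    simp

/-- Bounded Lipschitz test functions suffice. The error `4 * K / √i` at a root `i ≥ n` is at most `4
* K / √n`. -/
theorem IsRandomForest.tendstoInDistribution_nthRoot_rpow_mul (hw : IsRandomForest μ w a)
    (ha : 0 < a) (ha1 : a < 1) [IsProbabilityMeasure (expMeasure 1)] :
    TendstoInDistribution (fun (n : ℕ) (ω : Ω) => (nthRoot (fun k => w k ω) n : ℝ) ^ a *
      subtreeWeight w a (nthRoot (fun k => w k ω) n) ω) atTop (fun x : ℝ => x) (fun _ => μ)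
      (expMeasure 1) := by
  have hmeas : ∀ n : ℕ, AEMeasurable (fun ω => (nthRoot (fun k => w k ω) n : ℝ) ^ a *
      subtreeWeight w a (nthRoot (fun k => w k ω) n) ω) μ := fun n =>
    hw.aemeasurable_nthRoot ha1 (f := fun i ω => (i : ℝ) ^ a * subtreeWeight w a i ω)
      (fun i hi => (hw.measurable_subtreeWeight hi).const_mul _) n
  refine ⟨hmeas, aemeasurable_id, ?_⟩
  refine tendsto_iff_forall_lipschitz_integral_tendsto.2 ?_
  rintro F ⟨C, hC⟩ ⟨K, hK⟩
  have hM : ∀ x, |F x| ≤ |F 0| + C := fun x => by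
    have h1 := hC x 0
    rw [Real.dist_eq] at h1
    have := abs_sub_abs_le_abs_sub (F x) (F 0)
    linarith
  have hFm : Measurable F := hK.continuous.measurable
  simp only [ProbabilityMeasure.coe_mk]
  simp_rw [fun n => integral_map (hmeas n) hFm.aestronglyMeasurable, Measure.map_id']
  rw [tendsto_iff_norm_sub_tendsto_zero]
  have hz : Tendsto (fun n : ℕ => 4 * (K : ℝ) / Real.sqrt n) atTop (𝓝 0) :=
    tendsto_const_nhds.div_atTop (Real.tendsto_sqrt_atTop.comp tendsto_natCast_atTop_atTop)
  refine squeeze_zero' (.of_forall fun _ => norm_nonneg _) ?_ hz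
  filter_upwards [eventually_ge_atTop 1] with n hn
  rw [Real.norm_eq_abs]
  refine hw.abs_integral_nthRoot_sub_le ha1 (f := fun i x => F ((i : ℝ) ^ a * x))
    (fun i => hFm.comp (by fun_prop)) (fun i x => hM _) fun i hi hni => ?_
  have hWm := hw.measurable_subtreeWeight hi
  have := Measure.isProbabilityMeasure_map (μ := μ) hWm.aemeasurable
  have h := abs_integral_rpow_mul_sub_le (ν := μ.map (subtreeWeight w a i)) ha ha1.le
    (by exact_mod_cast hi) (hw.map_subtreeWeight_nonneg ha.le hi)
    (hw.lintegral_map_subtreeWeight ha hi) hM hK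
  have hFm' : Measurable fun x => F ((i : ℝ) ^ a * x) := hFm.comp (by fun_prop)
  rw [integral_map hWm.aemeasurable hFm'.aestronglyMeasurable] at h
  refine h.trans ?_
  have : (0 : ℝ) < n := by exact_mod_cast hn
  gcongr

/-- Slutsky's theorem, with `n ^ a` split into the `a`-th powers of the root and of `n` divided by
the root. -/
theorem IsRandomForest.tendstoInDistribution_rpow_mul (hw : IsRandomForest μ w a)
    (ha : 0 < a) (ha1 : a < 1) [IsProbabilityMeasure (expMeasure 1)] :
    TendstoInDistribution (fun (n : ℕ) (ω : Ω) => (n : ℝ) ^ a *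
      subtreeWeight w a (nthRoot (fun k => w k ω) n) ω) atTop (fun x : ℝ => x * (1 - a) ^ a)
      (fun _ => μ) (expMeasure 1) := by
  have hY : ∀ n : ℕ, AEMeasurable (fun ω => ((n : ℝ) / nthRoot (fun k => w k ω) n) ^ a) μ :=
    fun n => hw.aemeasurable_nthRoot ha1 (f := fun i _ => ((n : ℝ) / i) ^ a)
      (fun i _ => measurable_const) n
  have hYt : TendstoInMeasure μ (fun (n : ℕ) ω => ((n : ℝ) / nthRoot (fun k => w k ω) n) ^ a)
      atTop (fun _ => (1 - a) ^ a) := by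
    refine tendstoInMeasure_of_tendsto_ae (fun n => (hY n).aestronglyMeasurable) ?_
    filter_upwards [hw.ae_tendsto_nthRoot ha1] with ω hω
    exact hω.rpow_const (Or.inr ha.le)
  have h := (hw.tendstoInDistribution_nthRoot_rpow_mul ha
    ha1).continuous_comp_prodMk_of_tendstoInMeasure_const
    (g := fun p : ℝ × ℝ => p.1 * p.2) (by fun_prop) hYt hY
  refine h.congr (fun n => ?_) .rfl
  filter_upwards [hw.ae_infinite_roots ha1] with ω hω
  have hR : (0 : ℝ) < nthRoot (fun k => w k ω) n := by
    exact_mod_cast (mem_nthRootEvent (n := n) hω).1.one_le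
  have := Real.rpow_pos_of_pos hR a
  rw [Real.div_rpow (by positivity) hR.le]
  field_simp

end Roots

/-! ### From the destroyed recursive tree to the random forest. -/

/-- If the `X i` are independent, the `Y i` are independent, and both families are independent of
each other, then the pairs `(X i, Y i)` are independent. -/
theorem iIndepFun_prodMk_of_indepFun {Ω ι : Type*} {α β : ι → Type*} [MeasurableSpace Ω]
    [∀ i, MeasurableSpace (α i)] [∀ i, MeasurableSpace (β i)] {μ : Measure Ω}
    {X : ∀ i, Ω → α i} {Y : ∀ i, Ω → β i} (hXm : ∀ i, Measurable (X i))
    (hYm : ∀ i, Measurable (Y i)) (hX : iIndepFun X μ) (hY : iIndepFun Y μ)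
    (hXY : IndepFun (fun ω i => X i ω) (fun ω i => Y i ω) μ) :
    iIndepFun (fun i ω => (X i ω, Y i ω)) μ := by
  rw [iIndepFun_iff_iIndep]
  set R : ∀ i, Set (Set (α i × β i)) := fun i =>
    Set.image2 (· ×ˢ ·) {s | MeasurableSet s} {t | MeasurableSet t}
  refine iIndepSets.iIndep (fun i => ((hXm i).prodMk (hYm i)).comap_le)
    (fun i => {s | ∃ t ∈ R i, (fun ω => (X i ω, Y i ω)) ⁻¹' t = s})
    (fun i => isPiSystem_prod.comap _) (fun i => ?_) ?_
  · rw [← generateFrom_prod, MeasurableSpace.comap_generateFrom]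
    rfl
  · rw [iIndepSets_iff]
    intro S f hf
    choose! g hg using hf
    have : ∀ i ∈ S, ∃ A B, MeasurableSet A ∧ MeasurableSet B ∧ f i = X i ⁻¹' A ∩ Y i ⁻¹' B := by
      intro i hi
      obtain ⟨⟨A, hA, B, hB, hAB⟩, he⟩ := hg i hi
      refine ⟨A, B, hA, hB, ?_⟩
      rw [← he, ← hAB]
      rfl
    choose! A B hA hB hf using this
    have e1 : (⋂ i ∈ S, f i) = (fun ω i => X i ω) ⁻¹' (⋂ i ∈ S, Function.eval i ⁻¹' A i) ∩
        (fun ω i => Y i ω) ⁻¹' (⋂ i ∈ S, Function.eval i ⁻¹' B i) := by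
      rw [Set.iInter₂_congr hf]
      ext ω
      simp only [Set.mem_iInter, Set.mem_inter_iff, Set.mem_preimage, Function.eval]
      exact ⟨fun h => ⟨fun i hi => (h i hi).1, fun i hi => (h i hi).2⟩,
        fun h i hi => ⟨h.1 i hi, h.2 i hi⟩⟩
    have hpair : ∀ i ∈ S, μ (f i) = μ (X i ⁻¹' A i) * μ (Y i ⁻¹' B i) := by
      intro i hi
      rw [hf i hi]
      exact ((hXY.comp (measurable_pi_apply i)
        (measurable_pi_apply i)).measure_inter_preimage_eq_mul _ _ (hA i hi) (hB i hi))
    have hAm : MeasurableSet (⋂ i ∈ S, Function.eval i ⁻¹' A i) :=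
      Finset.measurableSet_biInter _ fun i hi => measurable_pi_apply i (hA i hi)
    have hBm : MeasurableSet (⋂ i ∈ S, Function.eval i ⁻¹' B i) :=
      Finset.measurableSet_biInter _ fun i hi => measurable_pi_apply i (hB i hi)
    rw [Finset.prod_congr rfl hpair, Finset.prod_mul_distrib, e1,
      hXY.measure_inter_preimage_eq_mul _ _ hAm hBm,
      ← hX.measure_inter_preimage_eq_mul S hA, ← hY.measure_inter_preimage_eq_mul S hB]
    simp only [Set.preimage_iInter]
    rfl

theorem expMeasure_real_Ioi {t : ℝ} (ht : 0 ≤ t) :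
    (expMeasure 1).real (Set.Ioi t) = Real.exp (-t) := by
  have := isProbabilityMeasure_expMeasure one_pos
  rw [← Set.compl_Iic, probReal_compl_eq_one_sub measurableSet_Iic, ← cdf_eq_real,
    cdf_expMeasure_eq one_pos, if_pos ht]
  simp

theorem uniformOn_real_singleton {j v : ℕ} (hv : 1 ≤ v) (hvj : v < j) :
    (uniformOn (Set.Icc 1 (j - 1)) : Measure ℕ).real {v} = 1 / (j - 1) := by
  have hfin : (Set.Icc 1 (j - 1) : Set ℕ).Finite := Set.finite_Icc _ _
  have hmem : v ∈ Set.Icc 1 (j - 1) := ⟨hv, by omega⟩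
  have hinter : Set.Icc 1 (j - 1) ∩ {v} = {v} := by simpa using hmem
  have hcard : Measure.count (Set.Icc 1 (j - 1) : Set ℕ) = ((j - 1 : ℕ) : ENNReal) := by
    rw [Measure.count_apply_finite _ hfin]
    simp
  rw [uniformOn, measureReal_def, cond_apply measurableSet_Icc, hinter, hcard,
    Measure.count_singleton, mul_one, ENNReal.toReal_inv, ENNReal.toReal_natCast,
    Nat.cast_sub (by omega)]
  simp

section Model

variable {Ω : Type*} [MeasurableSpace Ω] {μ : Measure Ω}
  {u : ℕ → Ω → ℕ} {ε : ℕ → Ω → ℝ} {t : ℝ}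

theorem IsModel.ae_parent_mem (h : IsModel μ u ε) :
    ∀ᵐ ω ∂μ, ∀ j, 2 ≤ j → 1 ≤ u j ω ∧ u j ω < j := by
  rw [ae_all_iff]
  intro j
  by_cases hj : 2 ≤ j
  · have hmem : ∀ᵐ v ∂(uniformOn (Set.Icc 1 (j - 1)) : Measure ℕ), v ∈ Set.Icc 1 (j - 1) :=
      ae_cond_mem measurableSet_Icc
    rw [← h.law_parent j hj] at hmem
    filter_upwards [ae_of_ae_map (h.measurable_parent j hj).aemeasurable hmem] with ω hω _
    obtain ⟨h1, h2⟩ := hω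
    omega
  · exact .of_forall fun ω h => absurd h hj

variable [IsProbabilityMeasure μ]

/-- The forest at time `t` is a random recursive forest with attachment parameter `exp (-t)`. -/
theorem IsModel.isRandomForest (h : IsModel μ u ε) (ht : 0 ≤ t) :
    IsRandomForest μ (fun j ω => keptParent (fun i => u i ω) (fun i => ε i ω) t j)
      (Real.exp (-t)) := by
  have hmeas : ∀ j, Measurable
      fun ω => keptParent (fun i => u i ω) (fun i => ε i ω) t j := by
    intro j
    by_cases hj : 2 ≤ j
    · have hu := h.measurable_parent j hj
      have he := h.measurable_time j hj
      refine Measurable.ite ?_ hu measurable_const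
      exact (measurableSet_lt measurable_const he).inter
        ((measurableSet_le measurable_const hu).inter (measurableSet_lt hu measurable_const))
    · have : (fun ω => keptParent (fun i => u i ω) (fun i => ε i ω) t j) = fun _ => 0 := by
        funext ω
        rw [keptParent, if_neg]
        omega
      rw [this]
      exact measurable_const
  have hprob : ∀ j v, 1 ≤ v → v < j →
      μ.real {ω | keptParent (fun i => u i ω) (fun i => ε i ω) t j = v} =
        Real.exp (-t) / (j - 1) := by
    intro j v hv hvj
    have hj : 2 ≤ j := by omega
    have hind : IndepFun (u j) (ε j) μ := h.indep_tree_time.comp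
      (measurable_pi_apply (⟨j, hj⟩ : {i : ℕ // 2 ≤ i}))
      (measurable_pi_apply (⟨j, hj⟩ : {i : ℕ // 2 ≤ i}))
    have e : {ω | keptParent (fun i => u i ω) (fun i => ε i ω) t j = v} =
        u j ⁻¹' {v} ∩ ε j ⁻¹' Set.Ioi t := by
      ext ω
      simp only [Set.mem_ofPred_eq, keptParent_eq_iff hv, Set.mem_inter_iff, Set.mem_preimage,
        Set.mem_singleton_iff, Set.mem_Ioi]
      tauto
    have e1 : μ.real (u j ⁻¹' {v}) = 1 / (j - 1) := by
      rw [← map_measureReal_apply (h.measurable_parent j hj) (MeasurableSet.singleton v),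
        h.law_parent j hj, uniformOn_real_singleton hv hvj]
    have e2 : μ.real (ε j ⁻¹' Set.Ioi t) = Real.exp (-t) := by
      rw [← map_measureReal_apply (h.measurable_time j hj) measurableSet_Ioi, h.law_time j hj,
        expMeasure_real_Ioi ht]
    rw [e, measureReal_def, hind.measure_inter_preimage_eq_mul _ _ (MeasurableSet.singleton v)
      measurableSet_Ioi, ENNReal.toReal_mul, ← measureReal_def, ← measureReal_def, e1, e2]
    ring
  refine ⟨hmeas, fun j ω hj => keptParent_lt hj, ?_, hprob, fun j hj => ?_⟩
  · have hpair := iIndepFun_prodMk_of_indepFun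
      (X := fun i : {i : ℕ // 2 ≤ i} => u i) (Y := fun i : {i : ℕ // 2 ≤ i} => ε i)
      (fun i => h.measurable_parent i.1 i.2)
      (fun i => h.measurable_time i.1 i.2) h.indep_parent h.indep_time h.indep_tree_time
    -- The kept parent of `i` uses only the pair at index `i`, so constant sequences can stand for
    -- `u` and `ε`.
    refine hpair.comp (fun (i : {i : ℕ // 2 ≤ i}) (z : ℕ × ℝ) =>
      keptParent (fun _ => z.1) (fun _ => z.2) t i.1) fun i => ?_
    refine Measurable.ite ?_ measurable_fst measurable_const
    exact (measurableSet_lt measurable_const measurable_snd).inter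
      ((measurableSet_le measurable_const measurable_fst).inter
        (measurableSet_lt measurable_fst measurable_const))
  · set w : Ω → ℕ := fun ω => keptParent (fun i => u i ω) (fun i => ε i ω) t j with hw
    -- The root probability is the complement of `j - 1` attachment probabilities, each equal to
    -- `exp (-t) / (j - 1)`.
    have hsum : ∑ v ∈ Finset.range j, μ.real (w ⁻¹' {v}) = 1 := by
      rw [sum_measureReal_preimage_singleton _ fun v _ => hmeas j (MeasurableSet.singleton v)]
      have : w ⁻¹' (Finset.range j : Set ℕ) = Set.univ := by
        ext ω
        simpa using keptParent_lt (by omega)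
      rw [this, probReal_univ]
    obtain ⟨k, rfl⟩ := Nat.exists_eq_add_of_le' (show 1 ≤ j by omega)
    rw [Finset.sum_range_succ'] at hsum
    have hterm : ∀ v ∈ Finset.range k, μ.real (w ⁻¹' {v + 1}) =
        Real.exp (-t) / ((k + 1 : ℕ) - 1) := fun v hv =>
      hprob (k + 1) (v + 1) (by omega) (by rw [Finset.mem_range] at hv; omega)
    rw [Finset.sum_congr rfl hterm, Finset.sum_const, Finset.card_range, nsmul_eq_mul] at hsum
    have hk : (k : ℝ) ≠ 0 := by
      have : k ≠ 0 := by omega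
      exact_mod_cast this
    have hk' : (k : ℝ) * (Real.exp (-t) / ((k + 1 : ℕ) - 1)) = Real.exp (-t) := by
      push_cast
      rw [add_sub_cancel_right, mul_div_cancel₀ _ hk]
    rw [hk'] at hsum
    have : μ.real {ω | w ω = 0} = μ.real (w ⁻¹' {0}) := rfl
    linarith

/-- The weight of the `n`-th block is that of the subtree of the `n`-th root. -/
theorem IsModel.ae_tendsto_partialWeight (h : IsModel μ u ε) (ht : 0 < t) (n : ℕ) :
    ∀ᵐ ω ∂μ, Tendsto (partialWeight t (block (fun i => u i ω) (fun i => ε i ω) t n)) atTop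
      (𝓝 (subtreeWeight (fun j ω => keptParent (fun i => u i ω) (fun i => ε i ω) t j)
        (Real.exp (-t)) (nthRoot (keptParent (fun i => u i ω) (fun i => ε i ω) t) n) ω)) := by
  have hw := h.isRandomForest ht.le
  have ha1 : Real.exp (-t) < 1 := Real.exp_lt_one_iff.2 (by linarith)
  have hW : ∀ᵐ ω ∂μ, ∀ i, 1 ≤ i → _ := ae_all_iff.2 fun i =>
    (show ∀ᵐ ω ∂μ, 1 ≤ i → _ from by
      by_cases hi : 1 ≤ i
      · exact (hw.ae_tendsto_subtreeSize (Real.exp_pos _).le hi).mono fun ω hω _ => hω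
      · exact .of_forall fun ω h => absurd h hi)
  filter_upwards [hW, h.ae_parent_mem, hw.ae_infinite_roots ha1] with ω hω hu hinf
  have hroot := (mem_nthRootEvent (n := n) hinf).1
  have hblock : block (fun i => u i ω) (fun i => ε i ω) t n = cluster (fun i => u i ω)
      (fun i => ε i ω) t (nthRoot (keptParent (fun i => u i ω) (fun i => ε i ω) t) n) := by
    rw [block, nthRoot]
    congr 2
    ext i
    exact isSmallest_iff_isRoot hu
  rw [hblock]
  refine (hω _ hroot.one_le).congr fun N => ?_
  exact (partialWeight_cluster hu hroot).symm

theorem IsModel.blockWeight_ae_eq (h : IsModel μ u ε) (ht : 0 < t) (n : ℕ) :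
    blockWeight u ε t n =ᵐ[μ] fun ω =>
      subtreeWeight (fun j ω => keptParent (fun i => u i ω) (fun i => ε i ω) t j)
        (Real.exp (-t)) (nthRoot (keptParent (fun i => u i ω) (fun i => ε i ω) t) n) ω := by
  filter_upwards [h.ae_tendsto_partialWeight ht n] with ω hω
  exact hω.limUnder_eq

theorem nthRoot_one (w : ℕ → ℕ) : nthRoot w 1 = 1 := by
  classical
  -- A one-point sample space makes the lemma on random parent maps apply to a single map.
  refine nthRoot_eq_of_mem (w := fun k (_ : Unit) => w k) (n := 1) (ω := ()) ⟨Or.inl rfl, ?_⟩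
  have h0 : ¬ IsRoot w 0 := fun h => absurd h.one_le (by omega)
  simp [rootCount, Nat.count_succ, h0]

end Model

end RecursiveTreeDestruction

/-! ### Conclusion: identification of the limit law. -/

theorem corollary3 {Ω : Type*} [MeasurableSpace Ω] (μ : Measure Ω) [IsProbabilityMeasure μ]
    (u : ℕ → Ω → ℕ) (ε : ℕ → Ω → ℝ) (h : RecursiveTreeDestruction.IsModel μ u ε)
    (t : ℝ) (ht : 0 < t) :
    (∀ n : ℕ, 1 ≤ n →
      AEMeasurable (RecursiveTreeDestruction.blockWeight u ε t n) μ ∧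
      ∀ᵐ ω ∂μ, 0 < RecursiveTreeDestruction.blockWeight u ε t n ω ∧
        Tendsto (RecursiveTreeDestruction.partialWeight t
          (RecursiveTreeDestruction.block (fun i => u i ω) (fun i => ε i ω) t n)) atTop
          (𝓝 (RecursiveTreeDestruction.blockWeight u ε t n ω))) ∧
    ∀ (Ω' : Type*) [MeasurableSpace Ω'] (P : Measure Ω') [IsProbabilityMeasure P]
      (V Y : Ω' → ℝ),
      HasLaw V (expMeasure (1 - Real.exp (-t))⁻¹) P →
      IdentDistrib Y (RecursiveTreeDestruction.blockWeight u ε t 1) P μ →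
      IndepFun V Y P →
      TendstoInDistribution
        (fun (n : ℕ) (ω : Ω) =>
          (n : ℝ) ^ Real.exp (-t) * RecursiveTreeDestruction.blockWeight u ε t n ω)
        atTop (fun ω' => V ω' ^ Real.exp (-t) * Y ω') (fun _ => μ) P := by
  open RecursiveTreeDestruction in
  have hw := h.isRandomForest ht.le
  have ha : 0 < Real.exp (-t) := Real.exp_pos _
  have ha1 : Real.exp (-t) < 1 := Real.exp_lt_one_iff.2 (by linarith)
  have heq := h.blockWeight_ae_eq ht
  set a := Real.exp (-t) with ha_def
  set w : ℕ → Ω → ℕ := fun j ω => keptParent (fun i => u i ω) (fun i => ε i ω) t j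
  refine ⟨fun n _ => ⟨?_, ?_⟩, ?_⟩
  · exact (hw.aemeasurable_nthRoot ha1 (f := subtreeWeight w a)
      (fun i hi => hw.measurable_subtreeWeight hi) n).congr (heq n).symm
  · have hpos : ∀ᵐ ω ∂μ, ∀ i, 1 ≤ i → 0 < subtreeWeight w a i ω := by
      refine ae_all_iff.2 fun i => ?_
      by_cases hi : 1 ≤ i
      · exact (hw.subtreeWeight_pos ha hi).mono fun ω hω _ => hω
      · exact .of_forall fun ω h => absurd h hi
    filter_upwards [heq n, h.ae_tendsto_partialWeight ht n, hpos, hw.ae_infinite_roots ha1]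
      with ω h1 h2 h3 h4
    rw [h1]
    exact ⟨h3 _ (mem_nthRootEvent (n := n) h4).1.one_le, h2⟩
  · intro Ω' _ P _ V Y hV hY hVY
    have hc : 0 < 1 - a := by linarith
    have hr : 0 < (1 - a)⁻¹ := inv_pos.2 hc
    have := isProbabilityMeasure_expMeasure one_pos
    have hWm : Measurable (subtreeWeight w a 1) := hw.measurable_subtreeWeight le_rfl
    have hYlaw : P.map Y = μ.map (subtreeWeight w a 1) := by
      rw [hY.map_eq, Measure.map_congr (heq 1)]
      simp only [nthRoot_one]
    have hZ : AEMeasurable (fun ω' => V ω' ^ a * Y ω') P :=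
      (hV.aemeasurable.pow_const a).mul hY.aemeasurable_fst
    have hpair : P.map (fun ω' => (V ω', Y ω')) =
        (gammaMeasure 1 (1 - a)⁻¹).prod (μ.map (subtreeWeight w a 1)) := by
      rw [(indepFun_iff_map_prod_eq_prod_map_map hV.aemeasurable hY.aemeasurable_fst).1 hVY,
        hV.map_eq, hYlaw]
      rfl
    have := Measure.isProbabilityMeasure_map (μ := μ) hWm.aemeasurable
    -- Shape `1` and rate `(1 - a)⁻¹` is the law of `V`, and vertex `1` is the first root. Thus `((1
    -- - a)⁻¹ * V) ^ a * Y` is standard exponential, and removing the scalar gives the factor `(1 -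
    -- a) ^ a` of the limit.
    have hexp := map_gamma_rpow_mul (ν := μ.map (subtreeWeight w a 1)) ha one_pos hr
      (hw.map_subtreeWeight_nonneg ha.le le_rfl)
      (by simpa using hw.lintegral_map_subtreeWeight ha le_rfl)
    have hlaw : P.map (fun ω' => V ω' ^ a * Y ω') =
        (expMeasure 1).map (fun x => x * (1 - a) ^ a) := by
      rw [← hexp, ← hpair, Measure.map_map (by fun_prop) (by fun_prop),
        AEMeasurable.map_map_of_aemeasurable (by fun_prop)
          (hV.aemeasurable.prodMk hY.aemeasurable_fst)]
      have hVpos : ∀ᵐ ω' ∂P, 0 < V ω' := by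
        refine ae_of_ae_map hV.aemeasurable ?_
        rw [hV.map_eq]
        exact gammaMeasure_pos
      refine Measure.map_congr ?_
      filter_upwards [hVpos] with ω' hv
      simp only [Function.comp_apply]
      rw [Real.mul_rpow hr.le hv.le, Real.inv_rpow hc.le]
      have := Real.rpow_pos_of_pos hc a
      field_simp
    have hlim := (hw.tendstoInDistribution_rpow_mul ha ha1).congr
      (Y := fun (n : ℕ) ω => (n : ℝ) ^ a * blockWeight u ε t n ω) (fun n => by
        filter_upwards [heq n] with ω hω
        rw [hω]) .rfl
    refine ⟨hlim.forall_aemeasurable, hZ, ?_⟩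
    have hE : (⟨P.map (fun ω' => V ω' ^ a * Y ω'), Measure.isProbabilityMeasure_map hZ⟩ :
        ProbabilityMeasure ℝ) = ⟨(expMeasure 1).map (fun x => x * (1 - a) ^ a),
          Measure.isProbabilityMeasure_map hlim.aemeasurable_limit⟩ := Subtype.ext hlaw
    rw [hE]
    exact hlim.tendsto
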